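/- **Setting.** A bandits-with-knapsacks instance has $m$ arms and $d$ resources. Each pull of arm $i$ gives an independent sample (reward, consumption vector) from a distribution $\pi_i$ on $[0,1]^{d+1}$, with mean reward $r_i$ and mean consumption $C_{\cdot,i}$. For horizon $T$ every resource has budget $B=bT$ with $b\in(0,1]$ fixed. The first resource is time, of which every pull consumes exactly $b$. Let $x^*=\xi^*/T$, where $\xi^*$ maximizes $r^\top\xi$ subject to $C\xi\le B$, $\xi\ge 0$. Assume that $\xi^*$ is the unique maximizer, that it is non-degenerate (as many optimal arms $\{i:\xi^*_i>0\}$ as binding constraints $\{j:(C\xi^*)_j=B\}$), and that all arms are optimal and all constraints are binding. Let $\delta=\frac1T\big(\mathrm{OPT}_{\mathrm{LP}}-\max_i\mathrm{OPT}_i\big)$, where $\mathrm{OPT}_{\mathrm{LP}}=r^\top\xi^*$ and $\mathrm{OPT}_i$ is the value of the LP with the additional constraint $\xi_i=0$. Let $\sigma$ be the smallest singular value of $C$, and let $\chi=\min_i x^*_i$. Put $$\alpha=\frac{\min\{1,\sigma\}\min\{\chi,\delta\}\,b}{d^{3/2}},\qquad \epsilon=\frac{\alpha}{5},\qquad \theta=\min\Big\{\frac{\min\{1,\sigma^2\}\min\{\chi,\delta\}}{12\min\{m^2,d^2\}},\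 \Big(2+\frac1b\Big)^{-2}\frac{\delta}{5}\Big\},$$ $$\epsilon_t=\begin{cases}\dfrac65, & t<\dfrac{\alpha T}{19},\\[2mm] \dfrac{19\,b\min\{m,d\}\sqrt d}{\sigma}\sqrt{\dfrac{\log T}{t}}+\dfrac{4\min\{m^{5/2},d^{5/2}\}\,\epsilon_{\mathrm{LP}}}{\sigma\log^2T}, & t\ge\dfrac{\alpha T}{19}.\end{cases}$$ **Algorithm.** Let $B^{(t)}$ be the vector of remaining budgets after round $t$, so that $B^{(0)}=(B,\dots,B)$, and let $b^{(t)}=B^{(t)}/(T-t)$. Let $n_i(t)$ be the number of pulls of arm $i$ in rounds $1,\dots,t$. Let $r^U_i(t)$ be the empirical mean reward plus $\sqrt{2\log T/n_i(t)}$, capped at $1$ (and equal to $1$ if $n_i(t)=0$). Let $C^L_{j,i}(t)$ be the empirical mean consumption minus $\sqrt{2\log T/n_i(t)}$, cut off at $0$ (and equal to $0$ if $n_i(t)=0$); for the time resource $C^L_{1,i}(t)=b$. As long as no budget is exceeded, round $t+1$ is as follows. The LP $$\max\ r^U(t)^\top\xi\quad\text{s.t.}\quad C^L(t)\xi\le B^{(t)},\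 \xi\ge0,$$ is solved; if $\|C^L_{\cdot,i}(t)-C_{\cdot,i}\|_\infty\le\theta$ for all $i$ and $b^{(t)}\in[b-\epsilon,b+\epsilon]$ entrywise, the constraint $C^L(t)\xi\ge B^{(t)}$ is added to it. The solver returns some $\xi\ge0$ whose objective value is within $\epsilon_{\mathrm{LP}}(T-t)/\log^2T$ of the optimum and which satisfies each linear inequality constraint up to the same error. An arm is then drawn with probabilities $\xi/\|\xi\|_1$ (by any rule if $\xi=0$) and pulled. Let $\mathcal H_t$ denote the information available after round $t$: all observations, and any internal randomness of the solver used for round $t+1$. Let $i_t$ be the arm pulled in round $t$ and let $c_t\in[0,1]^d$ be the consumption in that round. **Events.** For $t\in[T]$ let $$\mathcal E_t=\Big\{b^{(s)}\in[b-\epsilon,b+\epsilon]\text{ for all }s\in[t-1]\ \text{ and }\ \big\|\mathbb E[c_t\mid\mathcal H_{t-1}]-b^{(t-1)}\big\|_\infty>\epsilon_t\Big\}.$$ For a real number $K$ let $\mathcal G_t$ be the event that $\|C^L_{\cdot,i}(s)-C_{\cdot,i}\|_\infty\le\theta$ for all arms $i$ and all integers $s\ge 0$ with $K\log T\le s\le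 t-1$; that is, after an initial stage of at most $K\log T$ rounds the consumption estimates used up to round $t$ are $\theta$-accurate. **Lemma.** For every such instance and every $K$ there is a constant $\underline T$, depending only on the instance and on $K$, such that for all $T>\underline T$, all $0\le\epsilon_{\mathrm{LP}}\le\dfrac{\sigma\chi\log^2T}{40\min\{m^{3/2},d^{3/2}\}}$ and every run of the algorithm with horizon $T$, $$\mathbb P\Big(\bigcup_{t=1}^T(\mathcal E_t\cap\mathcal G_t)\Big)\le\frac{\min\{m,d\}}{T^3}.$$ -/

import Mathlib

open MeasureTheory ProbabilityTheory
open scoped Matrix ENNReal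

noncomputable section

namespace BwK

/-! ### The problem instance and its linear programs -/

/-- A bandits-with-knapsacks instance with `m` arms and `d` resources. `law i` is the joint
distribution of (reward, consumption vector) of one pull of arm `i`, supported on `[0,1]^(d+1)`.
`b` is the per-round budget (for horizon `T` each resource has budget `b * T`).
Resource `0` is time: every pull consumes exactly `b` units of it. -/
structure Instance (m d : ℕ) [NeZero d] where
  law : Fin m → Measure (ℝ × (Fin d → ℝ))
  isProb : ∀ i, IsProbabilityMeasure (law i)
  supp : ∀ i, ∀ᵐ z ∂(law i), z.1 ∈ Set.Icc (0 : ℝ) 1 ∧ ∀ j, z.2 j ∈ Set.Icc (0 : ℝ) 1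
  b : ℝ
  b_pos : 0 < b
  b_le_one : b ≤ 1
  time : ∀ i, ∀ᵐ z ∂(law i), z.2 0 = b

section Static

variable {m d : ℕ} [NeZero d] (I : Instance m d)

/-- Expected reward vector `r`. -/
def Instance.meanReward (i : Fin m) : ℝ := ∫ z, z.1 ∂(I.law i)

/-- Expected consumption matrix `C`, of size `d × m`. -/
def Instance.meanCost : Matrix (Fin d) (Fin m) ℝ := fun j i => ∫ z, z.2 j ∂(I.law i)

/-- Feasible set of the LP `max r ⬝ᵥ x` subject to `C x ≤ b`, `x ≥ 0`. This is the LP relaxation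
with budget `B = b T` in the per-round variable `x = ξ / T`. -/
def Instance.feasible : Set (Fin m → ℝ) :=
  {x | (∀ i, 0 ≤ x i) ∧ ∀ j, (I.meanCost *ᵥ x) j ≤ I.b}

/-- `x` is an optimal solution of the LP relaxation (per-round form). -/
def Instance.IsOptimal (x : Fin m → ℝ) : Prop :=
  x ∈ I.feasible ∧ ∀ y ∈ I.feasible, I.meanReward ⬝ᵥ y ≤ I.meanReward ⬝ᵥ x

/-- `OPT_i / T`: the LP value when arm `i` is removed. -/
def Instance.optArm (i : Fin m) : ℝ :=
  sSup {v | ∃ x ∈ I.feasible, x i = 0 ∧ v = I.meanReward ⬝ᵥ x}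

/-- `OPT_j / T`: the value of the dual LP associated with resource `j`. -/
def Instance.optRes (j : Fin d) : ℝ :=
  sInf {v | ∃ y : Fin d → ℝ, (∀ k, 0 ≤ y k) ∧
    (∀ i, I.meanReward i + I.meanCost j i ≤ (I.meanCostᵀ *ᵥ y) i) ∧ v = I.b * ∑ k, y k - I.b}

/-- Optimal arms, read off from the optimal solution `x`. -/
def optimalArms (x : Fin m → ℝ) : Finset (Fin m) := {i | 0 < x i}

open Classical in
/-- Binding constraints, read off from the optimal solution `x`. -/
def Instance.binding (x : Fin m → ℝ) : Finset (Fin d) := {j | (I.meanCost *ᵥ x) j = I.b}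

/-- `δ`: gap between the LP value and the best of the values `OPT_i` (`i` an optimal arm) and
`OPT_j` (`j` a non-binding constraint). -/
def Instance.gap (x : Fin m → ℝ) : ℝ :=
  I.meanReward ⬝ᵥ x -
    sSup ({v | ∃ i ∈ optimalArms x, v = I.optArm i} ∪ {v | ∃ j, j ∉ I.binding x ∧ v = I.optRes j})

/-- `χ`: the smallest non-zero entry of the optimal solution. -/
def minWeight (x : Fin m → ℝ) : ℝ := sInf {v | ∃ i, x i ≠ 0 ∧ v = x i}

/-- The smallest of the `min p q` singular values of a `p × q` matrix. -/
def sigmaMin {p q : Type*} [Fintype p] [Fintype q] [DecidableEq q] (A : Matrix p q ℝ) : ℝ :=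
  (Matrix.toEuclideanLin A).singularValues (min (Fintype.card p) (Fintype.card q) - 1)

/-- `σ`: the smallest singular value of `C` restricted to binding constraints and optimal arms. -/
def Instance.sigma (x : Fin m → ℝ) : ℝ :=
  sigmaMin (I.meanCost.submatrix (fun j : {j // j ∈ I.binding x} => (j : Fin d))
    (fun i : {i // i ∈ optimalArms x} => (i : Fin m)))

/-- `α = min{1,σ} min{χ,δ} b / d^{3/2}`. -/
def Instance.alpha (x : Fin m → ℝ) : ℝ :=
  min 1 (I.sigma x) * min (minWeight x) (I.gap x) * I.b / (d : ℝ) ^ (3 / 2 : ℝ)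

/-- `ε = α / 5`. -/
def Instance.eps (x : Fin m → ℝ) : ℝ := I.alpha x / 5

/-- The estimation accuracy `θ` at which the algorithm switches to the second linear program. -/
def Instance.theta (x : Fin m → ℝ) : ℝ :=
  min (min 1 (I.sigma x ^ 2) * min (minWeight x) (I.gap x) / (12 * min ((m : ℝ) ^ 2) ((d : ℝ) ^ 2)))
    (((2 + 1 / I.b) ^ 2)⁻¹ * (I.gap x / 5))

/-- The piecewise threshold `ε_t`. -/
def Instance.epsRound (x : Fin m → ℝ) (T : ℕ) (epsLP : ℝ) (t : ℕ) : ℝ :=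
  if (t : ℝ) < I.alpha x * T / 19 then 6 / 5
  else
    19 * I.b * min (m : ℝ) d * Real.sqrt d / I.sigma x * Real.sqrt (Real.log T / t)
      + 4 * min ((m : ℝ) ^ (5 / 2 : ℝ)) ((d : ℝ) ^ (5 / 2 : ℝ)) * epsLP
          / (I.sigma x * Real.log T ^ 2)

end Static

/-! ### Approximate LP solutions -/

section LP

variable {m d : ℕ}

/-- Feasible set of the residual LP: `C x ≤ B`, `x ≥ 0`. -/
def lpFeasible (C : Matrix (Fin d) (Fin m) ℝ) (B : Fin d → ℝ) : Set (Fin m → ℝ) :=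
  {x | (∀ i, 0 ≤ x i) ∧ ∀ j, (C *ᵥ x) j ≤ B j}

/-- Feasible set of the residual LP with the additional constraints `C x ≥ B`. -/
def lpFeasible₂ (C : Matrix (Fin d) (Fin m) ℝ) (B : Fin d → ℝ) : Set (Fin m → ℝ) :=
  {x | (∀ i, 0 ≤ x i) ∧ (∀ j, (C *ᵥ x) j ≤ B j) ∧ ∀ j, B j ≤ (C *ᵥ x) j}

/-- Optimal value of maximizing `r ⬝ᵥ x` over a feasible set. -/
def lpValue (r : Fin m → ℝ) (S : Set (Fin m → ℝ)) : ℝ := sSup ((fun x => r ⬝ᵥ x) '' S)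

/-- `x` is an `η`-optimal and `η`-feasible solution of the residual LP. -/
def IsApproxLP (r : Fin m → ℝ) (C : Matrix (Fin d) (Fin m) ℝ) (B : Fin d → ℝ) (η : ℝ)
    (x : Fin m → ℝ) : Prop :=
  (∀ i, 0 ≤ x i) ∧ (∀ j, (C *ᵥ x) j ≤ B j + η) ∧ |r ⬝ᵥ x - lpValue r (lpFeasible C B)| ≤ η

/-- `x` is an `η`-optimal and `η`-feasible solution of the residual LP with the additional
constraints `C x ≥ B`. -/
def IsApproxLP₂ (r : Fin m → ℝ) (C : Matrix (Fin d) (Fin m) ℝ) (B : Fin d → ℝ) (η : ℝ)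
    (x : Fin m → ℝ) : Prop :=
  (∀ i, 0 ≤ x i) ∧ (∀ j, (C *ᵥ x) j ≤ B j + η) ∧ (∀ j, B j - η ≤ (C *ᵥ x) j) ∧
    |r ⬝ᵥ x - lpValue r (lpFeasible₂ C B)| ≤ η

end LP

/-! ### The algorithm (exhausting the binding resources) -/

/-- What happens in rounds `1, 2, …`: the arm played, the reward received, the resources consumed,
and the output of the LP solver from which the arm is drawn (index `0` is not used). -/
structure History (m d : ℕ) (Ω : Type*) where
  arm : ℕ → Ω → Fin m
  rew : ℕ → Ω → ℝ
  cost : ℕ → Ω → Fin d → ℝ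
  sol : ℕ → Ω → Fin m → ℝ

section Dynamics

variable {m d : ℕ} [NeZero d] {Ω : Type*} (I : Instance m d) (X : History m d Ω) (T : ℕ)

/-- The rounds among `1, …, t` in which arm `i` is played. -/
def History.pulls (t : ℕ) (ω : Ω) (i : Fin m) : Finset ℕ :=
  (Finset.Icc 1 t).filter fun s => X.arm s ω = i

/-- Confidence radius `√(2 log T / n_i(t))`. -/
def History.radius (t : ℕ) (ω : Ω) (i : Fin m) : ℝ :=
  Real.sqrt (2 * Real.log T / (X.pulls t ω i).card)

/-- Upper confidence bound `r^U(t)`: empirical mean plus radius, capped at `1`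
(and equal to `1` before the first pull). -/
def History.rewardUCB (t : ℕ) (ω : Ω) (i : Fin m) : ℝ :=
  if (X.pulls t ω i).card = 0 then 1
  else min 1 ((∑ s ∈ X.pulls t ω i, X.rew s ω) / (X.pulls t ω i).card + X.radius T t ω i)

/-- Lower confidence bound `C^L(t)`: empirical mean minus radius, cut off at `0` (and equal to `0`
before the first pull). The consumption `b` of the resource time is known, not estimated. -/
def History.costLCB (t : ℕ) (ω : Ω) : Matrix (Fin d) (Fin m) ℝ := fun j i =>
  if j = 0 then I.b
  else if (X.pulls t ω i).card = 0 then 0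
  else max 0 ((∑ s ∈ X.pulls t ω i, X.cost s ω j) / (X.pulls t ω i).card - X.radius T t ω i)

/-- Remaining budget `B^{(t)}` after round `t`. -/
def History.budget (t : ℕ) (ω : Ω) (j : Fin d) : ℝ :=
  I.b * T - ∑ s ∈ Finset.Icc 1 t, X.cost s ω j

/-- Average remaining budget `b^{(t)} = B^{(t)} / (T - t)`. -/
def History.avgBudget (t : ℕ) (ω : Ω) (j : Fin d) : ℝ :=
  X.budget I T t ω j / ((T : ℝ) - t)

/-- No resource budget has been exceeded up to round `t`. -/
def History.Alive (t : ℕ) (ω : Ω) : Prop := ∀ j, 0 ≤ X.budget I T t ω j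

/-- `b^{(t)} ∈ [b - ε, b + ε]`, entrywise. -/
def History.InRange (x : Fin m → ℝ) (t : ℕ) (ω : Ω) : Prop :=
  ∀ j, X.avgBudget I T t ω j ∈ Set.Icc (I.b - I.eps x) (I.b + I.eps x)

/-- `‖C^L_{·,i}(t) - C_{·,i}‖_∞ ≤ θ` for every arm `i`. -/
def History.Accurate (x : Fin m → ℝ) (t : ℕ) (ω : Ω) : Prop :=
  ∀ i, ‖fun j => X.costLCB I T t ω j i - I.meanCost j i‖ ≤ I.theta x

/-- Solver accuracy `ε_LP (T - t) / log² T` for the LP that is solved after round `t`. -/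
def lpAccuracy (epsLP : ℝ) (t : ℕ) : ℝ := epsLP * ((T : ℝ) - t) / Real.log T ^ 2

/-- `X` is a run, with horizon `T`, of the second phase of the algorithm in the situation where all
arms are optimal and all constraints are binding. `ℱ t` is the information available after round
`t` (all observations, together with any internal randomness of the LP solver used to compute
`X.sol (t + 1)`). As long as no budget is exceeded, round `t + 1` uses an approximate solution
of the residual LP with coefficients `r^U(t)`, `C^L(t)`, `B^{(t)}`, with the additional constraints
if the estimates are `θ`-accurate and the average remaining budget is in range; given `ℱ t`, arm
`i` is played with probability proportional to the `i`-th entry of the solution (no rule is imposed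
if the solution is zero), and reward and consumption are then a fresh sample of `I.law i`. -/
structure IsRun [mΩ : MeasurableSpace Ω] (P : Measure Ω) (ℱ : Filtration ℕ mΩ)
    (x : Fin m → ℝ) (epsLP : ℝ) : Prop where
  arm_meas : ∀ t, Measurable[ℱ t] (X.arm t)
  rew_meas : ∀ t, Measurable[ℱ t] (X.rew t)
  cost_meas : ∀ t, Measurable[ℱ t] (X.cost t)
  sol_meas : ∀ t, Measurable[ℱ t] (X.sol (t + 1))
  rew_mem : ∀ t ω, X.rew t ω ∈ Set.Icc (0 : ℝ) 1
  cost_mem : ∀ t ω j, X.cost t ω j ∈ Set.Icc (0 : ℝ) 1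
  solver₂ : ∀ t < T, ∀ᵐ ω ∂P, X.Alive I T t ω →
    (X.Accurate I T x t ω ∧ X.InRange I T x t ω) →
    IsApproxLP₂ (X.rewardUCB T t ω) (X.costLCB I T t ω) (X.budget I T t ω)
      (lpAccuracy T epsLP t) (X.sol (t + 1) ω)
  solver₁ : ∀ t < T, ∀ᵐ ω ∂P, X.Alive I T t ω →
    ¬ (X.Accurate I T x t ω ∧ X.InRange I T x t ω) →
    IsApproxLP (X.rewardUCB T t ω) (X.costLCB I T t ω) (X.budget I T t ω)
      (lpAccuracy T epsLP t) (X.sol (t + 1) ω)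
  select : ∀ t < T, ∀ i, ∀ᵐ ω ∂P, X.Alive I T t ω → 0 < ∑ k, X.sol (t + 1) ω k →
    (P⟦{ω' | X.arm (t + 1) ω' = i} | ℱ t⟧) ω
      = X.sol (t + 1) ω i / ∑ k, X.sol (t + 1) ω k
  sample : ∀ t < T, ∀ i, ∀ S : Set (ℝ × (Fin d → ℝ)), MeasurableSet S →
    ∀ᵐ ω ∂P, X.Alive I T t ω →
      (P⟦{ω' | X.arm (t + 1) ω' = i ∧ (X.rew (t + 1) ω', X.cost (t + 1) ω') ∈ S} | ℱ t⟧) ω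
        = (P⟦{ω' | X.arm (t + 1) ω' = i} | ℱ t⟧) ω * (I.law i).real S

/-- The event `𝓔_t`: the average remaining budget is in range after each round `s ≤ t - 1`, and
the conditional expectation of the consumption in round `t` given the past differs from
`b^{(t-1)}` by more than `ε_t` in the sup norm. -/
def deviationEvent [mΩ : MeasurableSpace Ω] (P : Measure Ω) (ℱ : Filtration ℕ mΩ)
    (x : Fin m → ℝ) (epsLP : ℝ) (t : ℕ) : Set Ω :=
  {ω | (∀ s ∈ Finset.Icc 1 (t - 1), X.InRange I T x s ω) ∧
    I.epsRound x T epsLP t <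
      ‖fun j => (P[fun ω' => X.cost t ω' j | ℱ (t - 1)]) ω - X.avgBudget I T (t - 1) ω j‖}

/-- The estimates `C^L(s)` used after the initial stage of at most `K log T` rounds and before
round `t` are all `θ`-accurate. -/
def accurateEvent (x : Fin m → ℝ) (K : ℝ) (t : ℕ) : Set Ω :=
  {ω | ∀ s : ℕ, K * Real.log T ≤ s → s ≤ t - 1 → X.Accurate I T x s ω}

end Dynamics

end BwK

end

namespace BwK

/-! ### Singular values -/

section SingularValues

variable {p q : Type*} [Fintype p] [Fintype q] [DecidableEq q]

/-! Non-degeneracy with all arms optimal and all constraints binding makes `C` square, and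
uniqueness of the optimum makes it injective, so `σ > 0`. Early rounds are trivial: a mean
consumption lies in `[0,1]` and an in-range average budget in `[0, 6/5]`, so they never differ by
more than `6/5`.

In a late round on the accurate event, the two-sided LP forces `z = ξ/(T-t)` to solve `C^L z ≈
b^(t)` up to `e = ε_LP/log² T`. Invertibility of `C` then puts `z` near `x`
(`Instance.Stable.abs_sub_le`), so arm `i` is drawn with probability `p_i` between `2/3 x_i` and
`3/2 x_i`. By Azuma–Hoeffding for the pull indicators, arm `i` has by then been pulled `n_i ≥ x_i
t/2` times (`Typical.card_pulls_ge`).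

The mean consumption differs from `b^(t)` by at most `∑ p_i |C^L_{j,i} - C_{j,i}| + 4e`. Each
estimation error is of order `√(t log T)/n_i + √(log T/n_i)`. Since `p_i t ≤ 3 n_i`, the weight
`p_i` cancels the possibly small `x_i`, leaving at most `19 √(log T/t)` per arm
(`Typical.abs_mean_sub_le`). The bound `σ ≤ b√d` shows that this is below the stated threshold.

Thus, almost surely, the bad event occurs only if one of `d² + d` martingales is large before some
round `t`. A union bound over martingales and rounds (`IsRun.measure_not_concentrated_le`) gives
`d/T³`. -/

theorem sigmaMin_sq_mul_le (A : Matrix p q ℝ) (hpq : Fintype.card q ≤ Fintype.card p)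
    (v : q → ℝ) : sigmaMin A ^ 2 * ∑ i, v i ^ 2 ≤ ∑ j, (A *ᵥ v) j ^ 2 := by
  rcases isEmpty_or_nonempty q with hq | hq
  · simpa using Finset.sum_nonneg fun j _ => sq_nonneg _
  set L := Matrix.toEuclideanLin A with hL
  have hcard : 0 < Fintype.card q := Fintype.card_pos
  have hn : Module.finrank ℝ (EuclideanSpace ℝ q) = Fintype.card q := by simp
  set w : EuclideanSpace ℝ q := WithLp.toLp 2 v
  have hs := L.isSymmetric_adjoint_comp_self
  have hlt : Fintype.card q - 1 < Fintype.card q := by omega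
  -- As `A` has at least as many rows as columns, the index in `sigmaMin` is that of the last, hence
  -- smallest, eigenvalue of `L* L`. The inequality then follows coordinatewise in the eigenbasis.
  have hσ : sigmaMin A ^ 2 = hs.eigenvalues hn ⟨Fintype.card q - 1, hlt⟩ := by
    rw [sigmaMin, min_eq_right hpq]
    exact L.sq_singularValues_of_lt hn hlt
  have hL2 : ∑ j, (A *ᵥ v) j ^ 2 = inner ℝ ((LinearMap.adjoint L ∘ₗ L) w) w := by
    rw [LinearMap.comp_apply, LinearMap.adjoint_inner_left, real_inner_self_eq_norm_sq,
      EuclideanSpace.norm_sq_eq]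
    simp [L, w, Matrix.toLpLin_apply]
  have hw2 : ∑ i, v i ^ 2 = inner ℝ w w := by
    rw [real_inner_self_eq_norm_sq, EuclideanSpace.norm_sq_eq]
    simp [w]
  rw [hL2, hw2, hσ]
  set e := hs.eigenvectorBasis hn
  rw [← e.sum_inner_mul_inner w w, ← e.sum_inner_mul_inner ((LinearMap.adjoint L ∘ₗ L) w) w,
    Finset.mul_sum]
  refine Finset.sum_le_sum fun k _ => ?_
  have h1 : inner ℝ ((LinearMap.adjoint L ∘ₗ L) w) (e k)
      = hs.eigenvalues hn k * inner ℝ w (e k) := by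
    rw [hs w (e k), hs.apply_eigenvectorBasis hn k, inner_smul_right]
    rfl
  rw [h1, mul_assoc]
  refine mul_le_mul_of_nonneg_right (hs.eigenvalues_antitone hn ?_) ?_
  · exact Fin.le_def.2 (by have := k.2; simp; omega)
  · rw [real_inner_comm (e k) w]
    exact mul_self_nonneg _

theorem sigmaMin_pos [Nonempty q] (A : Matrix p q ℝ) (hpq : Fintype.card q ≤ Fintype.card p)
    (hA : ∀ v, A *ᵥ v = 0 → v = 0) : 0 < sigmaMin A := by
  have hcard : 0 < Fintype.card q := Fintype.card_pos
  rw [sigmaMin, min_eq_right hpq]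
  refine (LinearMap.injective_iff_forall_lt_finrank_singularValues_pos _).1 ?_ _ (by simp; omega)
  rw [injective_iff_map_eq_zero]
  intro w hw
  have h := hA (WithLp.ofLp w) (by
    have := congrArg WithLp.ofLp hw
    simpa [Matrix.toLpLin_apply] using this)
  ext i
  exact congrFun h i

end SingularValues

/-! ### The static problem -/

section Static

variable {d : ℕ} [NeZero d] (I : Instance d d) {x : Fin d → ℝ}

theorem Instance.meanCost_time {m : ℕ} (I : Instance m d) (i : Fin m) : I.meanCost 0 i = I.b := by
  have := I.isProb i
  rw [Instance.meanCost, integral_congr_ae (I.time i)]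
  simp

theorem Instance.meanCost_mem {m : ℕ} (I : Instance m d) (j : Fin d) (i : Fin m) :
    I.meanCost j i ∈ Set.Icc (0 : ℝ) 1 := by
  have := I.isProb i
  have h : ∀ᵐ z ∂(I.law i), z.2 j ∈ Set.Icc (0 : ℝ) 1 := (I.supp i).mono fun z hz => hz.2 j
  have hm : AEStronglyMeasurable (fun z : ℝ × (Fin d → ℝ) => z.2 j) (I.law i) :=
    (by fun_prop : Measurable fun z : ℝ × (Fin d → ℝ) => z.2 j).aestronglyMeasurable
  refine ⟨integral_nonneg_of_ae (h.mono fun z hz => hz.1), ?_⟩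
  have hi : Integrable (fun z : ℝ × (Fin d → ℝ) => z.2 j) (I.law i) :=
    Integrable.of_bound hm 1 (h.mono fun z hz => by
      rw [Real.norm_eq_abs, abs_of_nonneg hz.1]; exact hz.2)
  calc I.meanCost j i ≤ ∫ _, (1 : ℝ) ∂(I.law i) :=
        integral_mono_ae hi (integrable_const _) (h.mono fun z hz => hz.2)
    _ = 1 := by simp

theorem mulVec_time {m : ℕ} (I : Instance m d) (y : Fin m → ℝ) :
    (I.meanCost *ᵥ y) 0 = I.b * ∑ i, y i := by
  simp [Matrix.mulVec, dotProduct, I.meanCost_time, Finset.mul_sum]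

theorem pos_of_optimalArms {m : ℕ} {x : Fin m → ℝ} (harms : optimalArms x = Finset.univ)
    (i : Fin m) : 0 < x i := by
  have : i ∈ optimalArms x := harms ▸ Finset.mem_univ i
  simpa [optimalArms] using this

theorem Instance.mulVec_eq_of_binding {m : ℕ} (I : Instance m d) {x : Fin m → ℝ}
    (hbind : I.binding x = Finset.univ) (j : Fin d) : (I.meanCost *ᵥ x) j = I.b := by
  have : j ∈ I.binding x := hbind ▸ Finset.mem_univ j
  simpa [Instance.binding] using this

theorem Instance.sum_eq_one {m : ℕ} (I : Instance m d) {x : Fin m → ℝ}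
    (hbind : I.binding x = Finset.univ) : ∑ i, x i = 1 := by
  have h := I.mulVec_eq_of_binding hbind 0
  rw [mulVec_time] at h
  exact mul_left_cancel₀ I.b_pos.ne' (by rw [h, mul_one])

theorem minWeight_spec {m : ℕ} [NeZero m] {x : Fin m → ℝ}
    (harms : optimalArms x = Finset.univ) : 0 < minWeight x ∧ ∀ i, minWeight x ≤ x i := by
  have hx := pos_of_optimalArms harms
  have hset : {v | ∃ i, x i ≠ 0 ∧ v = x i} = Set.range x := by
    ext v
    constructor
    · rintro ⟨i, _, rfl⟩; exact ⟨i, rfl⟩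
    · rintro ⟨i, rfl⟩; exact ⟨i, (hx i).ne', rfl⟩
  have hfin : (Set.range x).Finite := Set.finite_range x
  have hne : (Set.range x).Nonempty := ⟨x 0, 0, rfl⟩
  rw [minWeight, hset]
  refine ⟨?_, fun i => csInf_le hfin.bddBelow ⟨i, rfl⟩⟩
  obtain ⟨i, hi⟩ := hne.csInf_mem hfin
  rw [← hi]
  exact hx i

/-- A kernel vector could be added to `x` with either sign without changing consumption. Since `x`
is positive, small multiples stay feasible; optimality makes the objective constant along this line,
which contradicts uniqueness unless the vector is zero. -/
theorem Instance.meanCost_injective {m : ℕ} (I : Instance m d) {x : Fin m → ℝ}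
    (hopt : I.IsOptimal x) (huniq : ∀ y, I.IsOptimal y → y = x)
    (harms : optimalArms x = Finset.univ) (v : Fin m → ℝ) (hv : I.meanCost *ᵥ v = 0) : v = 0 := by
  have hx := pos_of_optimalArms harms
  obtain ⟨s, hs, hsx⟩ : ∃ s : ℝ, 0 < s ∧ ∀ i, s * |v i| ≤ x i := by
    have h : ∀ᶠ s in nhdsWithin (0 : ℝ) (Set.Ioi 0), ∀ i, s * |v i| ≤ x i := by
      refine Filter.eventually_all.2 fun i => ?_
      have ht : Filter.Tendsto (fun s : ℝ => s * |v i|) (nhdsWithin 0 (Set.Ioi 0)) (nhds 0) := by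
        have : Filter.Tendsto (fun s : ℝ => s * |v i|) (nhds 0) (nhds (0 * |v i|)) :=
          Filter.Tendsto.mul_const _ Filter.tendsto_id
        rw [zero_mul] at this
        exact this.mono_left nhdsWithin_le_nhds
      exact (ht.eventually (gt_mem_nhds (hx i))).mono fun s hs => hs.le
    obtain ⟨s, h1, h2⟩ := (h.and self_mem_nhdsWithin).exists
    exact ⟨s, h2, h1⟩
  have hfeas : ∀ c : ℝ, |c| = s → x + c • v ∈ I.feasible := by
    intro c hc
    refine ⟨fun i => ?_, fun j => ?_⟩
    · have h1 := hsx i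
      rw [← hc, ← abs_mul] at h1
      have h2 := neg_abs_le (c * v i)
      simp only [Pi.add_apply, Pi.smul_apply, smul_eq_mul]
      linarith
    · rw [Matrix.mulVec_add, Matrix.mulVec_smul, hv, smul_zero, add_zero]
      exact hopt.1.2 j
  have h1 := hopt.2 _ (hfeas s (abs_of_pos hs))
  have h2 := hopt.2 _ (hfeas (-s) (by rw [abs_neg, abs_of_pos hs]))
  rw [dotProduct_add, dotProduct_smul, smul_eq_mul] at h1 h2
  have h3 : s * (I.meanReward ⬝ᵥ v) = 0 := by linarith
  have h4 : I.IsOptimal (x + s • v) := by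
    refine ⟨hfeas s (abs_of_pos hs), fun y hy => ?_⟩
    rw [dotProduct_add, dotProduct_smul, smul_eq_mul, h3, add_zero]
    exact hopt.2 y hy
  have h5 : s • v = 0 := by simpa using huniq _ h4
  exact (smul_eq_zero.1 h5).resolve_left hs.ne'

/-- The time constraint says `∑ y ≤ 1`, so the feasible set lies in the unit cube. -/
theorem Instance.isCompact_feasible {m : ℕ} (I : Instance m d) : IsCompact I.feasible := by
  have hclosed : IsClosed I.feasible := by
    have : I.feasible = (⋂ i, {x : Fin m → ℝ | 0 ≤ x i}) ∩
        ⋂ j, {x : Fin m → ℝ | (I.meanCost *ᵥ x) j ≤ I.b} := by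
      ext y; simp [Instance.feasible]
    rw [this]
    refine (isClosed_iInter fun i => isClosed_le continuous_const (continuous_apply i)).inter
      (isClosed_iInter fun j => isClosed_le ?_ continuous_const)
    simp only [Matrix.mulVec, dotProduct]
    fun_prop
  refine (isCompact_univ_pi fun _ : Fin m => isCompact_Icc (a := (0 : ℝ)) (b := 1)).of_isClosed_subset
    hclosed fun y hy i _ => ⟨hy.1 i, ?_⟩
  have h := hy.2 0
  rw [mulVec_time] at h
  have h1 : ∑ k, y k ≤ 1 := le_of_mul_le_mul_left (by rwa [mul_one]) I.b_pos
  exact (Finset.single_le_sum (fun k _ => hy.1 k) (Finset.mem_univ i)).trans h1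

/-- By compactness the value without arm `i` is attained. Equality would make its maximizer a second
optimum, one that vanishes at `i`. -/
theorem Instance.optArm_lt {m : ℕ} (I : Instance m d) {x : Fin m → ℝ}
    (hopt : I.IsOptimal x) (huniq : ∀ y, I.IsOptimal y → y = x)
    {i : Fin m} (hi : 0 < x i) : I.optArm i < I.meanReward ⬝ᵥ x := by
  have hcpt : IsCompact (I.feasible ∩ {y | y i = 0}) :=
    I.isCompact_feasible.inter_right (isClosed_eq (continuous_apply i) continuous_const)
  have hne : (I.feasible ∩ {y | y i = 0}).Nonempty :=
    ⟨0, ⟨fun _ => le_rfl, fun j => by simpa using I.b_pos.le⟩, rfl⟩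
  have hcont : Continuous fun y : Fin m → ℝ => I.meanReward ⬝ᵥ y := by
    simp only [dotProduct]
    fun_prop
  have hset : {v | ∃ y ∈ I.feasible, y i = 0 ∧ v = I.meanReward ⬝ᵥ y}
      = (fun y => I.meanReward ⬝ᵥ y) '' (I.feasible ∩ {y | y i = 0}) := by
    ext v
    constructor
    · rintro ⟨y, hy, h0, rfl⟩; exact ⟨y, ⟨hy, h0⟩, rfl⟩
    · rintro ⟨y, ⟨hy, h0⟩, rfl⟩; exact ⟨y, hy, h0, rfl⟩
  obtain ⟨y, ⟨hy, h0⟩, hsup⟩ := (hcpt.image hcont).sSup_mem (hne.image _)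
  rw [Instance.optArm, hset, ← hsup]
  refine lt_of_le_of_ne (hopt.2 y hy) fun heq => ?_
  have : y = x := huniq y ⟨hy, fun z hz => (hopt.2 z hz).trans heq.ge⟩
  rw [this] at h0
  exact hi.ne' h0

theorem Instance.gap_pos {m : ℕ} [NeZero m] (I : Instance m d) {x : Fin m → ℝ}
    (hopt : I.IsOptimal x) (huniq : ∀ y, I.IsOptimal y → y = x)
    (harms : optimalArms x = Finset.univ) (hbind : I.binding x = Finset.univ) :
    0 < I.gap x := by
  -- No constraint is slack, so the dual values contribute nothing and the supremum is over a finite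
  -- nonempty set.
  have hset : ({v | ∃ i ∈ optimalArms x, v = I.optArm i} ∪
      {v | ∃ j, j ∉ I.binding x ∧ v = I.optRes j}) = Set.range I.optArm := by
    ext v
    simp [harms, hbind, eq_comm]
  rw [Instance.gap, hset, sub_pos]
  obtain ⟨i, hi⟩ := (Set.range_nonempty I.optArm).csSup_mem (Set.finite_range _)
  rw [← hi]
  exact I.optArm_lt hopt huniq (pos_of_optimalArms harms i)

theorem Instance.sigma_sq_mul_le (harms : optimalArms x = Finset.univ)
    (hbind : I.binding x = Finset.univ) (v : Fin d → ℝ) :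
    I.sigma x ^ 2 * ∑ i, v i ^ 2 ≤ ∑ j, (I.meanCost *ᵥ v) j ^ 2 := by
  have h := sigmaMin_sq_mul_le (I.meanCost.submatrix
    (fun j : {j // j ∈ I.binding x} => (j : Fin d))
    (fun i : {i // i ∈ optimalArms x} => (i : Fin d))) (by simp [harms, hbind])
    (fun i => v i)
  have hA : ∀ f : Fin d → ℝ, ∑ i : {i // i ∈ optimalArms x}, f i = ∑ i, f i := fun f => by
    rw [Finset.sum_coe_sort (optimalArms x) f, harms]
  have hB : ∀ f : Fin d → ℝ, ∑ i : {i // i ∈ I.binding x}, f i = ∑ i, f i := fun f => by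
    rw [Finset.sum_coe_sort (I.binding x) f, hbind]
  rw [hA fun i => v i ^ 2] at h
  refine h.trans_eq ?_
  rw [← hB fun j => (I.meanCost *ᵥ v) j ^ 2]
  refine Finset.sum_congr rfl fun j _ => ?_
  congr 1
  exact hA fun i => I.meanCost j i * v i

theorem Instance.sigma_pos (hopt : I.IsOptimal x) (huniq : ∀ y, I.IsOptimal y → y = x)
    (harms : optimalArms x = Finset.univ) (hbind : I.binding x = Finset.univ) :
    0 < I.sigma x := by
  have : Nonempty {i // i ∈ optimalArms x} := ⟨⟨0, harms ▸ Finset.mem_univ _⟩⟩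
  refine sigmaMin_pos _ (by simp [harms, hbind]) fun v hv => ?_
  have h := I.meanCost_injective hopt huniq harms
    (fun i => v ⟨i, harms ▸ Finset.mem_univ i⟩) (by
      ext j
      have := congrFun hv ⟨j, hbind ▸ Finset.mem_univ j⟩
      rw [Pi.zero_apply] at this ⊢
      rw [← this]
      simp only [Matrix.mulVec, dotProduct, Matrix.submatrix_apply]
      refine Finset.sum_bij (fun i _ => ⟨i, harms ▸ Finset.mem_univ i⟩)
        (fun _ _ => Finset.mem_univ _) (fun a _ b _ hab => by simpa using hab)
        (fun b _ => ⟨b, Finset.mem_univ _, rfl⟩) fun _ _ => rfl)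
  ext i
  exact congrFun h i

/-- Solutions of `C v = a` are bounded by `√d ‖a‖_∞ / σ`. -/
theorem Instance.abs_le_of_mulVec (hσ : 0 < I.sigma x) (harms : optimalArms x = Finset.univ)
    (hbind : I.binding x = Finset.univ) {v : Fin d → ℝ} {a : ℝ} (ha : 0 ≤ a)
    (hv : ∀ j, |(I.meanCost *ᵥ v) j| ≤ a) (i : Fin d) :
    |v i| ≤ Real.sqrt d * a / I.sigma x := by
  have h := I.sigma_sq_mul_le harms hbind v
  have h1 : ∑ j, (I.meanCost *ᵥ v) j ^ 2 ≤ d * a ^ 2 := by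
    calc _ ≤ ∑ _j : Fin d, a ^ 2 :=
          Finset.sum_le_sum fun j _ => sq_le_sq' (abs_le.1 (hv j)).1 (abs_le.1 (hv j)).2
      _ = d * a ^ 2 := by simp
  have h2 : v i ^ 2 ≤ ∑ k, v k ^ 2 :=
    Finset.single_le_sum (f := fun k => v k ^ 2) (fun k _ => sq_nonneg _) (Finset.mem_univ i)
  rw [le_div_iff₀ hσ]
  refine le_of_sq_le_sq ?_ (by positivity)
  rw [mul_pow, mul_pow, Real.sq_sqrt (Nat.cast_nonneg d), sq_abs]
  nlinarith [mul_le_mul_of_nonneg_left h2 (sq_nonneg (I.sigma x))]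

/-- Solve `C w = e₀`. The time row gives `b ∑ w = 1`, so Cauchy–Schwarz bounds `‖w‖` below by
`1/(b√d)`, while `σ‖w‖ ≤ 1`. This is what absorbs the factor `b√d/σ` of `ε_t`. -/
theorem Instance.sigma_le (hopt : I.IsOptimal x) (huniq : ∀ y, I.IsOptimal y → y = x)
    (harms : optimalArms x = Finset.univ) (hbind : I.binding x = Finset.univ) :
    I.sigma x ≤ I.b * Real.sqrt d := by
  have hinj : Function.Injective I.meanCost.mulVecLin := by
    rw [injective_iff_map_eq_zero]
    exact fun v hv => I.meanCost_injective hopt huniq harms v hv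
  obtain ⟨w, hw⟩ := LinearMap.injective_iff_surjective.1 hinj (Pi.single 0 1)
  rw [Matrix.mulVecLin_apply] at hw
  have h := I.sigma_sq_mul_le harms hbind w
  have h0 : I.b * ∑ i, w i = 1 := by rw [← mulVec_time, hw]; simp
  have h1 : ∑ j, (I.meanCost *ᵥ w) j ^ 2 = 1 := by
    rw [hw]
    simp [Pi.single_apply]
  have h2 : (∑ i, w i) ^ 2 ≤ d * ∑ i, w i ^ 2 := by
    simpa using sq_sum_le_card_mul_sum_sq (s := Finset.univ) (f := w)
  refine le_of_sq_le_sq ?_ (mul_nonneg I.b_pos.le (Real.sqrt_nonneg _))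
  rw [mul_pow, Real.sq_sqrt (Nat.cast_nonneg d)]
  rw [h1] at h
  have hs : 1 ≤ I.b ^ 2 * d * ∑ i, w i ^ 2 := by
    calc (1 : ℝ) = I.b ^ 2 * (∑ i, w i) ^ 2 := by rw [← mul_pow, h0, one_pow]
      _ ≤ _ := by rw [mul_assoc]; exact mul_le_mul_of_nonneg_left h2 (sq_nonneg _)
  have hq : 0 ≤ ∑ i, w i ^ 2 := Finset.sum_nonneg fun _ _ => sq_nonneg _
  have hq' : 0 < ∑ i, w i ^ 2 := lt_of_le_of_ne hq fun h' => by rw [← h'] at hs; norm_num at hs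
  exact le_of_mul_le_mul_right (h.trans hs) hq'

end Static

/-! ### The Azuma–Hoeffding inequality -/

section Azuma

variable {Ω : Type*} [mΩ : MeasurableSpace Ω] {P : Measure Ω} [IsProbabilityMeasure P]
  {ℱ : Filtration ℕ mΩ} {D : ℕ → Ω → ℝ} {n : ℕ}

theorem integral_mul_eq_zero_of_condExp {𝒢 : MeasurableSpace Ω} (h𝒢 : 𝒢 ≤ mΩ) {W Y : Ω → ℝ}
    (hW : StronglyMeasurable[𝒢] W) {c : ℝ} (hWc : ∀ ω, |W ω| ≤ c) (hY : Integrable Y P)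
    (h0 : P[Y | 𝒢] =ᵐ[P] 0) : ∫ ω, W ω * Y ω ∂P = 0 := by
  have h := condExp_stronglyMeasurable_mul_of_bound h𝒢 hW hY c (Filter.Eventually.of_forall hWc)
  calc ∫ ω, W ω * Y ω ∂P = ∫ ω, (P[W * Y | 𝒢]) ω ∂P := (integral_condExp h𝒢).symm
    _ = ∫ _, (0 : ℝ) ∂P := integral_congr_ae (by
        filter_upwards [h, h0] with ω h1 h2
        rw [h1, Pi.mul_apply, h2, Pi.zero_apply, mul_zero])
    _ = 0 := by simp

/-- On `[-1,1]` the convex function `exp(l y)` lies below its chord `cosh l + y sinh l`. The `sinh`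
term integrates to zero against the past, so each increment costs one factor `cosh l`. -/
theorem mgf_sum_le_cosh_pow (hD : ∀ s, Measurable[ℱ s] (D s)) (hb : ∀ s ω, |D s ω| ≤ 1)
    (h0 : ∀ s < n, P[D (s + 1) | ℱ s] =ᵐ[P] 0) (l : ℝ) {k : ℕ} (hk : k ≤ n) :
    mgf (fun ω => ∑ s ∈ Finset.Icc 1 k, D s ω) P l ≤ Real.cosh l ^ k := by
  have hM : ∀ k, Measurable[ℱ k] fun ω => ∑ s ∈ Finset.Icc 1 k, D s ω := fun k =>
    Finset.measurable_sum _ fun s hs => (hD s).mono (ℱ.mono (Finset.mem_Icc.1 hs).2) le_rfl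
  have hMb : ∀ k ω, |∑ s ∈ Finset.Icc 1 k, D s ω| ≤ k := fun k ω =>
    (Finset.abs_sum_le_sum_abs _ _).trans
      ((Finset.sum_le_sum fun s _ => hb s ω).trans (by simp))
  induction k with
  | zero => simp [mgf]
  | succ k ih =>
    have ih := ih (by omega)
    set W : Ω → ℝ := fun ω => Real.exp (l * ∑ s ∈ Finset.Icc 1 k, D s ω) with hWdef
    have hWm : Measurable[ℱ k] W := Real.measurable_exp.comp ((hM k).const_mul l)
    have hWc : ∀ ω, |W ω| ≤ Real.exp (|l| * k) := fun ω => by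
      rw [abs_of_pos (Real.exp_pos _), Real.exp_le_exp]
      refine (le_abs_self _).trans ?_
      rw [abs_mul]
      exact mul_le_mul_of_nonneg_left (hMb k ω) (abs_nonneg l)
    have hWi : Integrable W P :=
      Integrable.of_bound (hWm.mono (ℱ.le k) le_rfl).aestronglyMeasurable _
        (Filter.Eventually.of_forall hWc)
    have hDm : Measurable (D (k + 1)) := (hD (k + 1)).mono (ℱ.le _) le_rfl
    have hDi : Integrable (D (k + 1)) P :=
      Integrable.of_bound hDm.aestronglyMeasurable 1 (Filter.Eventually.of_forall (hb _))
    have hWD : Integrable (fun ω => W ω * D (k + 1) ω) P :=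
      Integrable.of_bound ((hWm.mono (ℱ.le k) le_rfl).mul hDm).aestronglyMeasurable
        (Real.exp (|l| * k) * 1) (Filter.Eventually.of_forall fun ω => by
          rw [Real.norm_eq_abs, abs_mul]
          exact mul_le_mul (hWc ω) (hb _ ω) (abs_nonneg _) (Real.exp_pos _).le)
    have hz := integral_mul_eq_zero_of_condExp (ℱ.le k) hWm.stronglyMeasurable hWc hDi
      (h0 k (by omega))
    calc mgf (fun ω => ∑ s ∈ Finset.Icc 1 (k + 1), D s ω) P l
        ≤ ∫ ω, (Real.cosh l * W ω + Real.sinh l * (W ω * D (k + 1) ω)) ∂P := by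
          refine integral_mono_of_nonneg (Filter.Eventually.of_forall fun ω => (Real.exp_pos _).le)
            ((hWi.const_mul _).add (hWD.const_mul _)) (Filter.Eventually.of_forall fun ω => ?_)
          dsimp only
          rw [Finset.sum_Icc_succ_top (by omega), mul_add, Real.exp_add]
          have h1 := Real.exp_mul_le_cosh_add_mul_sinh (hb (k + 1) ω) l
          rw [mul_comm (D (k + 1) ω) l] at h1
          have h2 := mul_le_mul_of_nonneg_left h1
            (Real.exp_pos (l * ∑ s ∈ Finset.Icc 1 k, D s ω)).le
          refine h2.trans_eq ?_
          simp only [hWdef]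
          ring
      _ = Real.cosh l * ∫ ω, W ω ∂P := by
          rw [integral_add (hWi.const_mul _) (hWD.const_mul _), integral_const_mul,
            integral_const_mul, hz, mul_zero, add_zero]
      _ ≤ Real.cosh l * Real.cosh l ^ k :=
          mul_le_mul_of_nonneg_left ih (Real.cosh_pos l).le
      _ = Real.cosh l ^ (k + 1) := by ring

/-- Chernoff bound with `cosh l ≤ exp(l²/2)`. The real `t ≥ n` allows a sum over `t - 1` rounds to
be measured at scale `t`. -/
theorem measure_sum_ge_le (hD : ∀ s, Measurable[ℱ s] (D s)) (hb : ∀ s ω, |D s ω| ≤ 1)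
    (h0 : ∀ s < n, P[D (s + 1) | ℱ s] =ᵐ[P] 0) {t : ℝ} (hnt : n ≤ t) (ht : 0 < t) {u : ℝ}
    (hu : 0 ≤ u) :
    P.real {ω | Real.sqrt (2 * u * t) ≤ ∑ s ∈ Finset.Icc 1 n, D s ω} ≤ Real.exp (-u) := by
  set a := Real.sqrt (2 * u * t)
  have ha : a ^ 2 = 2 * u * t := Real.sq_sqrt (by positivity)
  -- This minimizes `-l a + t l²/2`; the minimum is `-a²/(2t) = -u`.
  set l := a / t
  have hl : 0 ≤ l := by positivity
  have hm : Measurable fun ω => ∑ s ∈ Finset.Icc 1 n, D s ω :=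
    Finset.measurable_sum _ fun s _ => (hD s).mono (ℱ.le s) le_rfl
  have hint : Integrable (fun ω => Real.exp (l * ∑ s ∈ Finset.Icc 1 n, D s ω)) P := by
    refine Integrable.of_bound (Real.measurable_exp.comp (hm.const_mul l)).aestronglyMeasurable
      (Real.exp (l * n)) (Filter.Eventually.of_forall fun ω => ?_)
    rw [Real.norm_eq_abs, abs_of_pos (Real.exp_pos _), Real.exp_le_exp]
    refine mul_le_mul_of_nonneg_left ?_ hl
    calc _ ≤ ∑ s ∈ Finset.Icc 1 n, (1 : ℝ) :=
          Finset.sum_le_sum fun s _ => (le_abs_self _).trans (hb s ω)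
      _ = n := by simp
  calc _ ≤ Real.exp (-l * a) * mgf (fun ω => ∑ s ∈ Finset.Icc 1 n, D s ω) P l :=
        measure_ge_le_exp_mul_mgf a hl hint
    _ ≤ Real.exp (-l * a) * Real.cosh l ^ n :=
        mul_le_mul_of_nonneg_left (mgf_sum_le_cosh_pow hD hb h0 l le_rfl) (Real.exp_pos _).le
    _ ≤ Real.exp (-l * a) * Real.exp (l ^ 2 / 2) ^ n :=
        mul_le_mul_of_nonneg_left
          (pow_le_pow_left₀ (Real.cosh_pos l).le (Real.cosh_le_exp_half_sq l) n)
          (Real.exp_pos _).le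
    _ = Real.exp (-l * a + n * (l ^ 2 / 2)) := by rw [Real.exp_add, ← Real.exp_nat_mul]
    _ ≤ Real.exp (-u) := by
        rw [Real.exp_le_exp]
        have h1 : (n : ℝ) * (l ^ 2 / 2) ≤ t * (l ^ 2 / 2) :=
          mul_le_mul_of_nonneg_right hnt (by positivity)
        have h2 : t * (l ^ 2 / 2) = u := by
          simp only [l, div_pow, ha]
          field_simp
        have h3 : l * a = 2 * u := by
          simp only [l]
          rw [div_mul_eq_mul_div, ← sq, ha]
          field_simp
        linarith

/-- Two-sided Azuma–Hoeffding inequality for bounded martingale differences. -/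
theorem measure_abs_sum_gt_le (hD : ∀ s, Measurable[ℱ s] (D s)) (hb : ∀ s ω, |D s ω| ≤ 1)
    (h0 : ∀ s < n, P[D (s + 1) | ℱ s] =ᵐ[P] 0) {t : ℝ} (hnt : n ≤ t) (ht : 0 < t) {u : ℝ}
    (hu : 0 ≤ u) :
    P {ω | Real.sqrt (2 * u * t) < |∑ s ∈ Finset.Icc 1 n, D s ω|}
      ≤ ENNReal.ofReal (2 * Real.exp (-u)) := by
  have h1 := measure_sum_ge_le hD hb h0 hnt ht hu
  have h2 := measure_sum_ge_le (P := P) (ℱ := ℱ) (D := fun s ω => -D s ω) (n := n)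
    (fun s => (hD s).neg) (fun s ω => by rw [abs_neg]; exact hb s ω) (fun s hs => by
      refine (condExp_neg (D (s + 1)) (ℱ s)).trans ?_
      filter_upwards [h0 s hs] with ω hω
      rw [Pi.neg_apply, hω, Pi.zero_apply, neg_zero]) hnt ht hu
  have hsub : {ω | Real.sqrt (2 * u * t) < |∑ s ∈ Finset.Icc 1 n, D s ω|} ⊆
      {ω | Real.sqrt (2 * u * t) ≤ ∑ s ∈ Finset.Icc 1 n, D s ω} ∪
      {ω | Real.sqrt (2 * u * t) ≤ ∑ s ∈ Finset.Icc 1 n, -D s ω} := by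
    intro ω hω
    rcases lt_abs.1 (Set.mem_ofPred_eq ▸ hω) with h | h
    · exact Or.inl h.le
    · right
      rw [Set.mem_ofPred_eq, Finset.sum_neg_distrib]
      exact h.le
  refine ((measure_mono hsub).trans (measure_union_le _ _)).trans ?_
  rw [two_mul (Real.exp (-u)), ENNReal.ofReal_add (Real.exp_pos _).le (Real.exp_pos _).le]
  refine add_le_add ?_ ?_
  · exact (ENNReal.le_ofReal_iff_toReal_le (measure_ne_top _ _) (Real.exp_pos _).le).2 h1
  · exact (ENNReal.le_ofReal_iff_toReal_le (measure_ne_top _ _) (Real.exp_pos _).le).2 h2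

end Azuma

/-! ### Consequences of the dynamics -/

section Run

variable {m d : ℕ} [NeZero d] {Ω : Type*} [mΩ : MeasurableSpace Ω] {P : Measure Ω}
  {ℱ : Filtration ℕ mΩ} {I : Instance m d} {X : History m d Ω} {T : ℕ}
  {x : Fin m → ℝ} {epsLP : ℝ}

/-- The event that arm `i` is played in round `s`. -/
noncomputable def History.armEvent (X : History m d Ω) (s : ℕ) (i : Fin m) : Set Ω := {ω | X.arm s ω = i}

/-- The event that no budget is exceeded after round `t`. -/
noncomputable def History.aliveEvent (X : History m d Ω) (I : Instance m d) (T t : ℕ) : Set Ω :=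
  {ω | X.Alive I T t ω}

/-- Noise of the consumption of resource `j` by arm `i` in round `s`. -/
noncomputable def History.costDev (X : History m d Ω) (I : Instance m d) (T : ℕ) (i : Fin m) (j : Fin d)
    (s : ℕ) : Ω → ℝ :=
  (X.aliveEvent I T (s - 1) ∩ X.armEvent s i).indicator fun ω => X.cost s ω j - I.meanCost j i

/-- Conditional probability that arm `i` is played in round `s`, as a `[0,1]`-valued function. -/
noncomputable def History.armProb (X : History m d Ω) (P : Measure Ω) (ℱ : Filtration ℕ mΩ) (i : Fin m)
    (s : ℕ) (ω : Ω) : ℝ :=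
  max 0 (min 1 ((P⟦X.armEvent s i | ℱ (s - 1)⟧) ω))

/-- Noise of the indicator that arm `i` is played in round `s`. -/
noncomputable def History.armDev (X : History m d Ω) (P : Measure Ω) (ℱ : Filtration ℕ mΩ) (i : Fin m)
    (s : ℕ) (ω : Ω) : ℝ :=
  (X.armEvent s i).indicator (fun _ => (1 : ℝ)) ω - X.armProb P ℱ i s ω

/-- Clipping in `armProb` makes the bound hold at every `ω`, as the Azuma inequality requires, and
not only almost surely. -/
theorem History.abs_armDev_le (i : Fin m) (s : ℕ) (ω : Ω) : |X.armDev P ℱ i s ω| ≤ 1 := by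
  have h1 : X.armProb P ℱ i s ω ∈ Set.Icc (0 : ℝ) 1 :=
    ⟨le_max_left _ _, max_le zero_le_one (min_le_left _ _)⟩
  have h2 : (X.armEvent s i).indicator (fun _ => (1 : ℝ)) ω ∈ Set.Icc (0 : ℝ) 1 :=
    ⟨Set.indicator_nonneg (fun _ _ => zero_le_one) ω,
      Set.indicator_le_self' (fun _ _ => zero_le_one) ω⟩
  rw [History.armDev, abs_le]
  constructor <;> linarith [h1.1, h1.2, h2.1, h2.2]

namespace IsRun

theorem measurableSet_armEvent (hX : IsRun I X T P ℱ x epsLP) (s : ℕ) (i : Fin m) : MeasurableSet[ℱ s] (X.armEvent s i) :=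
  hX.arm_meas s (measurableSet_singleton i)

theorem measurable_cost (hX : IsRun I X T P ℱ x epsLP) (s : ℕ) (j : Fin d) : Measurable[ℱ s] fun ω => X.cost s ω j :=
  (measurable_pi_apply j).comp (hX.cost_meas s)

theorem abs_cost_sub_le (hX : IsRun I X T P ℱ x epsLP) (i : Fin m) (j : Fin d) (s : ℕ) (ω : Ω) :
    |X.cost s ω j - I.meanCost j i| ≤ 1 := by
  have h1 := hX.cost_mem s ω j
  have h2 := I.meanCost_mem j i
  rw [abs_le]
  constructor <;> linarith [h1.1, h1.2, h2.1, h2.2]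

theorem measurable_budget (hX : IsRun I X T P ℱ x epsLP) (t : ℕ) (j : Fin d) : Measurable[ℱ t] fun ω => X.budget I T t ω j :=
  Measurable.const_sub (Finset.measurable_sum _ fun s hs =>
    (hX.measurable_cost s j).mono (ℱ.mono (Finset.mem_Icc.1 hs).2) le_rfl) _

theorem measurableSet_aliveEvent (hX : IsRun I X T P ℱ x epsLP) (t : ℕ) : MeasurableSet[ℱ t] (X.aliveEvent I T t) := by
  have : X.aliveEvent I T t = ⋂ j, {ω | 0 ≤ X.budget I T t ω j} := by
    ext ω; simp [History.aliveEvent, History.Alive]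
  rw [this]
  exact MeasurableSet.iInter fun j => measurableSet_le measurable_const (hX.measurable_budget t j)

theorem measurable_costDev (hX : IsRun I X T P ℱ x epsLP) (i : Fin m) (j : Fin d) (s : ℕ) :
    Measurable[ℱ s] (X.costDev I T i j s) :=
  ((hX.measurable_cost s j).sub_const _).indicator
    ((ℱ.mono (Nat.sub_le s 1) _ (hX.measurableSet_aliveEvent _)).inter
      (hX.measurableSet_armEvent s i))

theorem abs_costDev_le (hX : IsRun I X T P ℱ x epsLP) (i : Fin m) (j : Fin d) (s : ℕ) (ω : Ω) :
    |X.costDev I T i j s ω| ≤ 1 := by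
  by_cases h : ω ∈ X.aliveEvent I T (s - 1) ∩ X.armEvent s i
  · rw [History.costDev, Set.indicator_of_mem h]
    exact hX.abs_cost_sub_le i j s ω
  · rw [History.costDev, Set.indicator_of_notMem h]
    simp

theorem measurable_armDev (hX : IsRun I X T P ℱ x epsLP) (i : Fin m) (s : ℕ) : Measurable[ℱ s] (X.armDev P ℱ i s) := by
  refine (measurable_const.indicator (hX.measurableSet_armEvent s i)).sub ?_
  exact measurable_const.max (measurable_const.min
    (stronglyMeasurable_condExp.measurable.mono (ℱ.mono (Nat.sub_le s 1)) le_rfl))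

variable [IsProbabilityMeasure P]

theorem measure_sample (hX : IsRun I X T P ℱ x epsLP) {t : ℕ} (ht : t < T) (i : Fin m) {A : Set Ω} (hA : MeasurableSet[ℱ t] A)
    (hAl : A ⊆ X.aliveEvent I T t) {S : Set (ℝ × (Fin d → ℝ))} (hS : MeasurableSet S) :
    P.real (A ∩ {ω | X.arm (t + 1) ω = i ∧ (X.rew (t + 1) ω, X.cost (t + 1) ω) ∈ S})
      = P.real (A ∩ X.armEvent (t + 1) i) * (I.law i).real S := by
  have hle := ℱ.le t
  have harm : MeasurableSet (X.armEvent (t + 1) i) := ℱ.le _ _ (hX.measurableSet_armEvent _ i)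
  have hE : MeasurableSet
      {ω | X.arm (t + 1) ω = i ∧ (X.rew (t + 1) ω, X.cost (t + 1) ω) ∈ S} :=
    harm.inter ((((hX.rew_meas (t + 1)).mono (ℱ.le _) le_rfl).prodMk
      ((hX.cost_meas (t + 1)).mono (ℱ.le _) le_rfl)) hS)
  have key : ∀ E : Set Ω, MeasurableSet E → P.real (A ∩ E) = ∫ ω in A, (P⟦E | ℱ t⟧) ω ∂P := by
    intro E hE
    rw [setIntegral_condExp hle ((integrable_const _).indicator hE) hA,
      setIntegral_indicator hE]
    simp
  rw [key _ hE, key _ harm, ← integral_mul_const]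
  refine setIntegral_congr_ae (hle _ hA) ?_
  filter_upwards [hX.sample t ht i S hS] with ω hω hωA
  exact hω (hAl hωA)

theorem integral_sample (hX : IsRun I X T P ℱ x epsLP) {t : ℕ} (ht : t < T) (i : Fin m) {A : Set Ω} (hA : MeasurableSet[ℱ t] A)
    (hAl : A ⊆ X.aliveEvent I T t) {f : ℝ × (Fin d → ℝ) → ℝ} (hf : Measurable f) :
    ∫ ω in A ∩ X.armEvent (t + 1) i, f (X.rew (t + 1) ω, X.cost (t + 1) ω) ∂P
      = P.real (A ∩ X.armEvent (t + 1) i) * ∫ z, f z ∂(I.law i) := by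
  have := I.isProb i
  have hZ : Measurable fun ω => (X.rew (t + 1) ω, X.cost (t + 1) ω) :=
    ((hX.rew_meas (t + 1)).mono (ℱ.le _) le_rfl).prodMk
      ((hX.cost_meas (t + 1)).mono (ℱ.le _) le_rfl)
  have harm : MeasurableSet (X.armEvent (t + 1) i) := ℱ.le _ _ (hX.measurableSet_armEvent _ i)
  -- On a past event within the alive event, the observation of a pull of arm `i` has law `I.law i`
  -- up to total mass.
  have hmap : (P.restrict (A ∩ X.armEvent (t + 1) i)).map
      (fun ω => (X.rew (t + 1) ω, X.cost (t + 1) ω))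
      = P (A ∩ X.armEvent (t + 1) i) • I.law i := by
    ext S hS
    rw [Measure.map_apply hZ hS, Measure.restrict_apply (hZ hS), Measure.smul_apply, smul_eq_mul]
    have h := hX.measure_sample ht i hA hAl hS
    rw [measureReal_def, measureReal_def, measureReal_def, ← ENNReal.toReal_mul,
      ENNReal.toReal_eq_toReal_iff' (measure_ne_top _ _)
        (ENNReal.mul_ne_top (measure_ne_top _ _) (measure_ne_top _ _))] at h
    rw [← h]
    congr 1
    ext ω
    simp only [Set.mem_inter_iff, Set.mem_preimage, History.armEvent, Set.mem_ofPred_eq]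
    tauto
  rw [← integral_map (f := f) hZ.aemeasurable hf.aestronglyMeasurable, hmap, integral_smul_measure,
    smul_eq_mul, measureReal_def]

theorem cost_time (hX : IsRun I X T P ℱ x epsLP) {t : ℕ} (ht : t < T) :
    ∀ᵐ ω ∂P, X.Alive I T t ω → X.cost (t + 1) ω 0 = I.b := by
  have hS : MeasurableSet {z : ℝ × (Fin d → ℝ) | z.2 0 ≠ I.b} :=
    (measurableSet_eq_fun (by fun_prop) measurable_const).compl
  have h : ∀ i, ∀ᵐ ω ∂P, ω ∉ X.aliveEvent I T t ∩ {ω | X.arm (t + 1) ω = i ∧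
      (X.rew (t + 1) ω, X.cost (t + 1) ω) ∈ {z : ℝ × (Fin d → ℝ) | z.2 0 ≠ I.b}} := by
    intro i
    have := I.isProb i
    rw [← measure_eq_zero_iff_ae_notMem, ← measureReal_eq_zero_iff,
      hX.measure_sample ht i (hX.measurableSet_aliveEvent t) subset_rfl hS]
    have h0 : (I.law i) {z | z.2 0 ≠ I.b} = 0 := I.time i
    rw [measureReal_def, measureReal_def, h0]
    simp
  filter_upwards [ae_all_iff.2 h] with ω hω hal
  by_contra hne
  exact hω (X.arm (t + 1) ω) ⟨hal, rfl, hne⟩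

theorem integrable_costDev (hX : IsRun I X T P ℱ x epsLP) (i : Fin m) (j : Fin d) (s : ℕ) :
    Integrable (X.costDev I T i j s) P :=
  Integrable.of_bound ((hX.measurable_costDev i j s).mono (ℱ.le s) le_rfl).aestronglyMeasurable 1
    (Filter.Eventually.of_forall (hX.abs_costDev_le i j s))

/-- Fresh sampling is guaranteed only while no budget is exceeded. The alive event belongs to `ℱ t`,
so building its indicator into `costDev` gives a martingale difference in every round before `T`. -/
theorem condExp_costDev (hX : IsRun I X T P ℱ x epsLP) (i : Fin m) (j : Fin d) {t : ℕ} (ht : t < T) :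
    P[X.costDev I T i j (t + 1) | ℱ t] =ᵐ[P] 0 := by
  have := I.isProb i
  refine (ae_eq_condExp_of_forall_setIntegral_eq (ℱ.le t) (hX.integrable_costDev i j (t + 1))
    (fun _ _ _ => integrableOn_zero) (fun A hA _ => ?_) aestronglyMeasurable_zero).symm
  have hal := hX.measurableSet_aliveEvent t
  have harm : MeasurableSet (X.armEvent (t + 1) i) := ℱ.le _ _ (hX.measurableSet_armEvent _ i)
  have h := hX.integral_sample ht i (hA.inter hal) Set.inter_subset_right
    (f := fun z => z.2 j - I.meanCost j i) (by fun_prop)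
  have hint : Integrable (fun z : ℝ × (Fin d → ℝ) => z.2 j) (I.law i) :=
    Integrable.of_bound
      (by fun_prop : Measurable fun z : ℝ × (Fin d → ℝ) => z.2 j).aestronglyMeasurable 1
      ((I.supp i).mono fun z hz => by
        rw [Real.norm_eq_abs, abs_of_nonneg (hz.2 j).1]; exact (hz.2 j).2)
  have h0 : ∫ z, (z.2 j - I.meanCost j i) ∂(I.law i) = 0 := by
    rw [integral_sub hint (integrable_const _)]
    simp [Instance.meanCost]
  rw [h0, mul_zero] at h
  have h5 : ∫ ω in A, X.costDev I T i j (t + 1) ω ∂P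
      = ∫ ω in A ∩ (X.aliveEvent I T t ∩ X.armEvent (t + 1) i),
        (X.cost (t + 1) ω j - I.meanCost j i) ∂P :=
    setIntegral_indicator ((ℱ.le _ _ hal).inter harm)
  rw [h5, ← Set.inter_assoc]
  simpa using h.symm

theorem armProb_ae (hX : IsRun I X T P ℱ x epsLP) (i : Fin m) (s : ℕ) :
    X.armProb P ℱ i s =ᵐ[P] P⟦X.armEvent s i | ℱ (s - 1)⟧ := by
  have harm : MeasurableSet (X.armEvent s i) := ℱ.le _ _ (hX.measurableSet_armEvent _ i)
  have hint : Integrable ((X.armEvent s i).indicator fun _ => (1 : ℝ)) P :=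
    (integrable_const _).indicator harm
  have h0 : 0 ≤ᵐ[P] P⟦X.armEvent s i | ℱ (s - 1)⟧ :=
    condExp_nonneg (Filter.Eventually.of_forall fun ω =>
      Set.indicator_nonneg (fun _ _ => zero_le_one) ω)
  have h1 : P⟦X.armEvent s i | ℱ (s - 1)⟧ ≤ᵐ[P] P[fun _ => (1 : ℝ) | ℱ (s - 1)] :=
    condExp_mono hint (integrable_const _) (Filter.Eventually.of_forall fun ω =>
      Set.indicator_le_self' (fun _ _ => zero_le_one) ω)
  rw [condExp_const (ℱ.le _)] at h1
  filter_upwards [h0, h1] with ω h0 h1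
  rw [Pi.zero_apply] at h0
  rw [History.armProb, min_eq_right h1, max_eq_right h0]

theorem condExp_armDev (hX : IsRun I X T P ℱ x epsLP) (i : Fin m) (t : ℕ) : P[X.armDev P ℱ i (t + 1) | ℱ t] =ᵐ[P] 0 := by
  have harm : MeasurableSet (X.armEvent (t + 1) i) := ℱ.le _ _ (hX.measurableSet_armEvent _ i)
  have hint : Integrable ((X.armEvent (t + 1) i).indicator fun _ => (1 : ℝ)) P :=
    (integrable_const _).indicator harm
  have h1 : X.armDev P ℱ i (t + 1) =ᵐ[P]
      (X.armEvent (t + 1) i).indicator (fun _ => (1 : ℝ)) - P⟦X.armEvent (t + 1) i | ℱ t⟧ := by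
    filter_upwards [hX.armProb_ae i (t + 1)] with ω hω
    rw [History.armDev, hω]
    rfl
  refine (condExp_congr_ae h1).trans ((condExp_sub hint integrable_condExp _).trans ?_)
  rw [condExp_of_stronglyMeasurable (ℱ.le t) stronglyMeasurable_condExp integrable_condExp,
    sub_self]

theorem condExp_cost (hX : IsRun I X T P ℱ x epsLP) (j : Fin d) {t : ℕ} (ht : t < T) :
    ∀ᵐ ω ∂P, X.Alive I T t ω → (P[fun ω' => X.cost (t + 1) ω' j | ℱ t]) ω
      = ∑ i, X.armProb P ℱ i (t + 1) ω * I.meanCost j i := by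
  have harm : ∀ i, MeasurableSet (X.armEvent (t + 1) i) :=
    fun i => ℱ.le _ _ (hX.measurableSet_armEvent _ i)
  have hal := hX.measurableSet_aliveEvent t
  have hint : ∀ i, Integrable ((X.armEvent (t + 1) i).indicator fun _ => (1 : ℝ)) P :=
    fun i => (integrable_const _).indicator (harm i)
  have hcost : Integrable (fun ω => X.cost (t + 1) ω j) P :=
    Integrable.of_bound
      ((hX.measurable_cost (t + 1) j).mono (ℱ.le _) le_rfl).aestronglyMeasurable 1
      (Filter.Eventually.of_forall fun ω => by
        have := hX.cost_mem (t + 1) ω j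
        rw [Real.norm_eq_abs, abs_of_nonneg this.1]; exact this.2)
  set Z : Ω → ℝ := ∑ i, I.meanCost j i • (X.armEvent (t + 1) i).indicator fun _ => (1 : ℝ)
  have hZi : ∀ i ∈ Finset.univ,
      Integrable (I.meanCost j i • (X.armEvent (t + 1) i).indicator fun _ => (1 : ℝ)) P :=
    fun i _ => (hint i).smul _
  have hZ : Integrable Z P := integrable_finsetSum' _ hZi
  -- While alive, consumption is the mean of the arm pulled plus noise; only the noise of that arm
  -- is nonzero.
  have hsplit : (X.aliveEvent I T t).indicator ((fun ω => X.cost (t + 1) ω j) - Z)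
      = ∑ i, X.costDev I T i j (t + 1) := by
    ext ω
    rw [Finset.sum_apply]
    have hoff : ∀ i, ω ∉ X.aliveEvent I T t ∩ X.armEvent (t + 1) i →
        X.costDev I T i j (t + 1) ω = 0 := fun i hi => Set.indicator_of_notMem hi _
    by_cases h : ω ∈ X.aliveEvent I T t
    · have hon : X.costDev I T (X.arm (t + 1) ω) j (t + 1) ω
          = X.cost (t + 1) ω j - I.meanCost j (X.arm (t + 1) ω) :=
        Set.indicator_of_mem (s := X.aliveEvent I T t ∩ X.armEvent (t + 1) (X.arm (t + 1) ω))
          ⟨h, rfl⟩ _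
      rw [Set.indicator_of_mem h, Finset.sum_eq_single (X.arm (t + 1) ω)
        (fun i _ hi => hoff i fun h' => hi h'.2.symm) (by simp), hon]
      simp [Z, Set.indicator_apply, History.armEvent]
    · rw [Set.indicator_of_notMem h, Finset.sum_eq_zero fun i _ => hoff i fun h' => h h'.1]
  have h1 := condExp_indicator (m := ℱ t) (hcost.sub hZ) hal
  have h2 := condExp_finsetSum (μ := P) (s := Finset.univ)
    (fun i _ => hX.integrable_costDev i j (t + 1)) (ℱ t)
  rw [hsplit] at h1
  have h3 := condExp_finsetSum (μ := P) (s := Finset.univ) hZi (ℱ t)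
  have h4 : ∀ᵐ ω ∂P, ∀ i, (P[I.meanCost j i • (X.armEvent (t + 1) i).indicator
      (fun _ => (1 : ℝ)) | ℱ t]) ω = X.armProb P ℱ i (t + 1) ω * I.meanCost j i := by
    refine ae_all_iff.2 fun i => ?_
    filter_upwards [condExp_smul (μ := P) (I.meanCost j i)
      ((X.armEvent (t + 1) i).indicator fun _ => (1 : ℝ)) (ℱ t), hX.armProb_ae i (t + 1)]
      with ω h5 h6
    rw [h5, h6, Pi.smul_apply, smul_eq_mul, mul_comm]
    rfl
  filter_upwards [h1, h2, h3, h4, condExp_sub hcost hZ (ℱ t),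
    ae_all_iff.2 fun i => hX.condExp_costDev i j ht] with ω h1 h2 h3 h4 h5 h6 hω
  rw [Set.indicator_of_mem (show ω ∈ X.aliveEvent I T t from hω), h2, Finset.sum_apply, h5,
    Pi.sub_apply, h3, Finset.sum_apply] at h1
  simp only [h6, h4, Pi.zero_apply, Finset.sum_const_zero] at h1
  linarith

theorem armProb_eq (hX : IsRun I X T P ℱ x epsLP) (i : Fin m) {t : ℕ} (ht : t < T) :
    ∀ᵐ ω ∂P, X.Alive I T t ω → 0 < ∑ k, X.sol (t + 1) ω k →
      X.armProb P ℱ i (t + 1) ω = X.sol (t + 1) ω i / ∑ k, X.sol (t + 1) ω k := by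
  filter_upwards [hX.armProb_ae i (t + 1), hX.select t ht i] with ω h1 h2 h3 h4
  rw [h1]
  exact h2 h3 h4

end IsRun

end Run

/-! ### Stability of the linear program -/

section Stability

variable {d : ℕ} [NeZero d] {I : Instance d d} {x : Fin d → ℝ}

/-- The consequences of non-degeneracy used in the stability analysis. -/
structure Instance.Stable (I : Instance d d) (x : Fin d → ℝ) : Prop where
  arms : optimalArms x = Finset.univ
  bind : I.binding x = Finset.univ
  sigma_pos : 0 < I.sigma x
  sigma_le : I.sigma x ≤ I.b * Real.sqrt d
  gap_pos : 0 < I.gap x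

theorem one_le_natCast_of_neZero : (1 : ℝ) ≤ d := by
  exact_mod_cast Nat.one_le_iff_ne_zero.2 (NeZero.ne d)

theorem one_le_sqrt_natCast : (1 : ℝ) ≤ Real.sqrt d :=
  Real.one_le_sqrt.2 one_le_natCast_of_neZero

theorem natCast_rpow_three_halves : (d : ℝ) ^ (3 / 2 : ℝ) = d * Real.sqrt d := by
  have hd : (0 : ℝ) < d := zero_lt_one.trans_le one_le_natCast_of_neZero
  rw [Real.sqrt_eq_rpow, show (3 / 2 : ℝ) = 1 + 1 / 2 by norm_num, Real.rpow_add hd,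
    Real.rpow_one]

theorem sqrt_natCast_le_rpow_five_halves : Real.sqrt d ≤ (d : ℝ) ^ (5 / 2 : ℝ) := by
  rw [Real.sqrt_eq_rpow]
  exact Real.rpow_le_rpow_of_exponent_le one_le_natCast_of_neZero (by norm_num)

namespace Instance.Stable

theorem minWeight_pos (hI : I.Stable x) : 0 < minWeight x := (minWeight_spec hI.arms).1

theorem minWeight_le (hI : I.Stable x) (i : Fin d) : minWeight x ≤ x i := (minWeight_spec hI.arms).2 i

theorem minWeight_le_one (hI : I.Stable x) : minWeight x ≤ 1 := by
  rw [← I.sum_eq_one hI.bind]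
  exact (hI.minWeight_le 0).trans
    (Finset.single_le_sum (fun i _ => (pos_of_optimalArms hI.arms i).le) (Finset.mem_univ 0))

theorem alpha_pos (hI : I.Stable x) : 0 < I.alpha x := by
  have h1 := lt_min one_pos hI.sigma_pos
  have h2 := lt_min hI.minWeight_pos hI.gap_pos
  have h3 := I.b_pos
  have h4 : (0 : ℝ) < d := zero_lt_one.trans_le one_le_natCast_of_neZero
  unfold Instance.alpha
  positivity

theorem eps_pos (hI : I.Stable x) : 0 < I.eps x := div_pos hI.alpha_pos (by norm_num)

theorem eps_le (hI : I.Stable x) : I.eps x ≤ I.b / 5 := by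
  have h4 : (1 : ℝ) ≤ (d : ℝ) ^ (3 / 2 : ℝ) :=
    Real.one_le_rpow one_le_natCast_of_neZero (by norm_num)
  have h2 := (lt_min hI.minWeight_pos hI.gap_pos).le
  have h3 : min (minWeight x) (I.gap x) ≤ 1 := (min_le_left _ _).trans hI.minWeight_le_one
  have h5 : min 1 (I.sigma x) * min (minWeight x) (I.gap x) ≤ 1 :=
    mul_le_one₀ (min_le_left _ _) h2 h3
  refine div_le_div_of_nonneg_right ?_ (by norm_num)
  rw [Instance.alpha, div_le_iff₀ (by linarith)]
  nlinarith [mul_le_mul_of_nonneg_right h5 I.b_pos.le, mul_le_mul_of_nonneg_left h4 I.b_pos.le]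

/-- `√d a/σ` is the displacement of a solution caused by an error `a` in `C z`. Budget drift may use
`χ/5` of it, estimation `χ/12` and the solver `χ/40`. -/
theorem sqrt_mul_eps_le (hI : I.Stable x) : Real.sqrt d * I.eps x / I.sigma x ≤ minWeight x / 5 := by
  have hd1 : (1 : ℝ) ≤ d := one_le_natCast_of_neZero
  have hs1 : (1 : ℝ) ≤ Real.sqrt d := one_le_sqrt_natCast
  have hσ := hI.sigma_pos
  have hχ := hI.minWeight_pos
  have h2 := (lt_min hI.minWeight_pos hI.gap_pos).le
  have h1 : min 1 (I.sigma x) * min (minWeight x) (I.gap x) ≤ I.sigma x * minWeight x :=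
    mul_le_mul (min_le_right _ _) (min_le_left _ _) h2 hσ.le
  have h3 : min 1 (I.sigma x) * min (minWeight x) (I.gap x) * I.b ≤ I.sigma x * minWeight x :=
    (mul_le_of_le_one_right (mul_nonneg (le_min zero_le_one hσ.le) h2) I.b_le_one).trans h1
  have h4 : I.alpha x * (d * Real.sqrt d) ≤ I.sigma x * minWeight x := by
    rw [Instance.alpha, natCast_rpow_three_halves, div_mul_cancel₀ _ (by positivity)]
    exact h3
  rw [div_le_iff₀ hσ, Instance.eps]
  have h5 : I.alpha x * Real.sqrt d ≤ I.alpha x * (d * Real.sqrt d) :=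
    mul_le_mul_of_nonneg_left (le_mul_of_one_le_left (by positivity) hd1) hI.alpha_pos.le
  linarith

theorem sqrt_mul_theta_le (hI : I.Stable x) : Real.sqrt d * I.theta x / I.sigma x ≤ minWeight x / 12 := by
  have hd1 : (1 : ℝ) ≤ d := one_le_natCast_of_neZero
  have hσ := hI.sigma_pos
  have hχ := hI.minWeight_pos
  have h2 := (lt_min hI.minWeight_pos hI.gap_pos).le
  have hm : min 1 (I.sigma x ^ 2) ≤ I.sigma x := by
    rcases le_total (I.sigma x) 1 with h | h
    · exact (min_le_right _ _).trans (by nlinarith)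
    · exact (min_le_left _ _).trans h
  have h1 : min 1 (I.sigma x ^ 2) * min (minWeight x) (I.gap x) ≤ I.sigma x * minWeight x :=
    mul_le_mul hm (min_le_left _ _) h2 hσ.le
  have h3 : I.theta x ≤ I.sigma x * minWeight x / (12 * (d : ℝ) ^ 2) := by
    refine (min_le_left _ _).trans ?_
    rw [min_self]
    exact div_le_div_of_nonneg_right h1 (by positivity)
  have h4 : Real.sqrt d ≤ (d : ℝ) ^ 2 := by
    refine Real.sqrt_le_iff.2 ⟨by positivity, ?_⟩
    calc (d : ℝ) = (d : ℝ) ^ 1 := (pow_one _).symm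
      _ ≤ (d : ℝ) ^ 4 := pow_le_pow_right₀ hd1 (by norm_num)
      _ = ((d : ℝ) ^ 2) ^ 2 := by ring
  rw [div_le_iff₀ hσ]
  calc Real.sqrt d * I.theta x
      ≤ Real.sqrt d * (I.sigma x * minWeight x / (12 * (d : ℝ) ^ 2)) :=
        mul_le_mul_of_nonneg_left h3 (Real.sqrt_nonneg _)
    _ ≤ (d : ℝ) ^ 2 * (I.sigma x * minWeight x / (12 * (d : ℝ) ^ 2)) :=
        mul_le_mul_of_nonneg_right h4 (by positivity)
    _ = minWeight x / 12 * I.sigma x := by field_simp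

theorem theta_nonneg (hI : I.Stable x) : 0 ≤ I.theta x := by
  have h2 := (lt_min hI.minWeight_pos hI.gap_pos).le
  have h3 := hI.gap_pos.le
  have h4 := hI.sigma_pos
  have h5 : 0 ≤ min 1 (I.sigma x ^ 2) := le_min zero_le_one (sq_nonneg _)
  refine le_min ?_ (by positivity)
  rw [min_self]
  positivity

theorem sqrt_mul_le (hI : I.Stable x) {e : ℝ}
    (he : e ≤ I.sigma x * minWeight x / (40 * (d : ℝ) ^ (3 / 2 : ℝ))) (he0 : 0 ≤ e) :
    Real.sqrt d * e / I.sigma x ≤ minWeight x / 40 ∧ e ≤ I.b / 40 := by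
  have hd1 : (1 : ℝ) ≤ d := one_le_natCast_of_neZero
  have hs1 : (1 : ℝ) ≤ Real.sqrt d := one_le_sqrt_natCast
  have hσ := hI.sigma_pos
  have hχ := hI.minWeight_pos
  rw [natCast_rpow_three_halves, le_div_iff₀ (by positivity)] at he
  have h1 : Real.sqrt d * e ≤ minWeight x / 40 * I.sigma x := by
    have : Real.sqrt d * e ≤ d * (Real.sqrt d * e) :=
      le_mul_of_one_le_left (by positivity) hd1
    linarith
  refine ⟨(div_le_iff₀ hσ).2 h1, ?_⟩
  have h2 : Real.sqrt d * e ≤ Real.sqrt d * (I.b / 40) := by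
    calc Real.sqrt d * e ≤ minWeight x / 40 * I.sigma x := h1
      _ ≤ 1 / 40 * (I.b * Real.sqrt d) :=
        mul_le_mul (by linarith [hI.minWeight_le_one]) hI.sigma_le hσ.le (by norm_num)
      _ = _ := by ring
  exact le_of_mul_le_mul_left h2 (by linarith)

/-- Approximate solutions of the perturbed system `A z ≈ β` are close to `x`. -/
theorem abs_sub_le (hI : I.Stable x) {A : Matrix (Fin d) (Fin d) ℝ} {β z : Fin d → ℝ} {e : ℝ} (he0 : 0 ≤ e)
    (he : e ≤ I.sigma x * minWeight x / (40 * (d : ℝ) ^ (3 / 2 : ℝ)))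
    (hA : ∀ j i, |A j i - I.meanCost j i| ≤ I.theta x) (hA0 : ∀ i, A 0 i = I.b)
    (hβ : ∀ j, |β j - I.b| ≤ I.eps x) (hβ0 : β 0 = I.b)
    (hz : ∀ i, 0 ≤ z i) (hAz : ∀ j, |(A *ᵥ z) j - β j| ≤ e) :
    |∑ i, z i - 1| ≤ e / I.b ∧ |∑ i, z i - 1| ≤ 1 / 40 ∧
      ∀ i, |z i - x i| ≤ 5 / 16 * x i := by
  have hb := I.b_pos
  obtain ⟨he1, he2⟩ := hI.sqrt_mul_le he he0
  -- The time row is known exactly and its average budget stays `b`, so only the solver error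
  -- affects the total mass.
  have hS : |∑ i, z i - 1| ≤ e / I.b := by
    have h := hAz 0
    have h1 : (A *ᵥ z) 0 = I.b * ∑ i, z i := by
      simp [Matrix.mulVec, dotProduct, hA0, Finset.mul_sum]
    rw [h1, hβ0, show I.b * ∑ i, z i - I.b = I.b * (∑ i, z i - 1) by ring, abs_mul,
      abs_of_pos hb] at h
    rwa [le_div_iff₀' hb]
  have hS' : |∑ i, z i - 1| ≤ 1 / 40 :=
    hS.trans ((div_le_iff₀ hb).2 (by linarith))
  refine ⟨hS, hS', fun i => ?_⟩
  have hsum : ∑ i, z i ≤ 41 / 40 := by linarith [(abs_le.1 hS').2]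
  have hC : ∀ j, |(I.meanCost *ᵥ (z - x)) j| ≤ 41 / 40 * I.theta x + e + I.eps x := by
    intro j
    have h1 : |∑ k, (I.meanCost j k - A j k) * z k| ≤ 41 / 40 * I.theta x := by
      calc _ ≤ ∑ k, |(I.meanCost j k - A j k) * z k| := Finset.abs_sum_le_sum_abs _ _
        _ ≤ ∑ k, I.theta x * z k := Finset.sum_le_sum fun k _ => by
            rw [abs_mul, abs_of_nonneg (hz k), abs_sub_comm]
            exact mul_le_mul_of_nonneg_right (hA j k) (hz k)
        _ = I.theta x * ∑ k, z k := by rw [Finset.mul_sum]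
        _ ≤ _ := by rw [mul_comm]; exact mul_le_mul_of_nonneg_right hsum hI.theta_nonneg
    -- Three sources: estimation, solver and budget drift; `C x = b` supplies the last term.
    have h2 : (I.meanCost *ᵥ (z - x)) j
        = ∑ k, (I.meanCost j k - A j k) * z k + ((A *ᵥ z) j - β j) + (β j - I.b) := by
      rw [Matrix.mulVec_sub, Pi.sub_apply, I.mulVec_eq_of_binding hI.bind]
      simp only [Matrix.mulVec, dotProduct, sub_mul, Finset.sum_sub_distrib]
      ring
    rw [h2]
    exact (abs_add_three _ _ _).trans (by linarith [hAz j, hβ j])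
  have h := I.abs_le_of_mulVec hI.sigma_pos hI.arms hI.bind
    (by linarith [hI.theta_nonneg, hI.eps_pos]) hC i
  have h3 : Real.sqrt d * (41 / 40 * I.theta x + e + I.eps x) / I.sigma x
      = 41 / 40 * (Real.sqrt d * I.theta x / I.sigma x) + Real.sqrt d * e / I.sigma x
        + Real.sqrt d * I.eps x / I.sigma x := by ring
  rw [h3, Pi.sub_apply] at h
  -- The constants fit: `41/480 + 1/40 + 1/5 ≤ 5/16`.
  linarith [hI.sqrt_mul_eps_le, hI.sqrt_mul_theta_le, hI.minWeight_le i, hI.minWeight_pos]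

/-- The sampling distribution of a perturbed system is close to `x`, and its mean consumption is
close to the right-hand side. -/
theorem normalized_bounds (hI : I.Stable x) {A : Matrix (Fin d) (Fin d) ℝ} {β z : Fin d → ℝ} {e : ℝ} (he0 : 0 ≤ e)
    (he : e ≤ I.sigma x * minWeight x / (40 * (d : ℝ) ^ (3 / 2 : ℝ)))
    (hA : ∀ j i, |A j i - I.meanCost j i| ≤ I.theta x) (hA0 : ∀ i, A 0 i = I.b)
    (hβ : ∀ j, |β j - I.b| ≤ I.eps x) (hβ0 : β 0 = I.b)
    (hz : ∀ i, 0 ≤ z i) (hAz : ∀ j, |(A *ᵥ z) j - β j| ≤ e) :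
    0 < ∑ i, z i ∧ (∀ i, 2 / 3 * x i ≤ z i / ∑ k, z k ∧ z i / ∑ k, z k ≤ 3 / 2 * x i) ∧
      ∀ j, |∑ i, z i / (∑ k, z k) * I.meanCost j i - β j|
        ≤ ∑ i, z i / (∑ k, z k) * |A j i - I.meanCost j i| + 4 * e := by
  obtain ⟨h1, h2, h3⟩ := hI.abs_sub_le he0 he hA hA0 hβ hβ0 hz hAz
  have hb := I.b_pos
  set S := ∑ i, z i with hSdef
  obtain ⟨hS1, hS2⟩ := abs_le.1 h2
  have hS : 0 < S := by linarith
  refine ⟨hS, fun i => ?_, fun j => ?_⟩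
  · obtain ⟨h4, h5⟩ := abs_le.1 (h3 i)
    have hx := pos_of_optimalArms hI.arms i
    rw [le_div_iff₀ hS, div_le_iff₀ hS]
    -- Indeed `(11/16)/(41/40) ≥ 2/3` and `(21/16)/(39/40) ≤ 3/2`.
    constructor <;> nlinarith
  · have hp : ∀ i, 0 ≤ z i / S := fun i => div_nonneg (hz i) hS.le
    have hsplit : ∑ i, z i / S * I.meanCost j i - β j
        = ∑ i, z i / S * (I.meanCost j i - A j i) + ((A *ᵥ z) j - β j) / S
          + β j * (1 - S) / S := by
      simp only [mul_sub, Finset.sum_sub_distrib]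
      have : ∑ i, z i / S * A j i = (A *ᵥ z) j / S := by
        simp only [Matrix.mulVec, dotProduct, Finset.sum_div]
        exact Finset.sum_congr rfl fun i _ => by ring
      rw [this]
      field_simp
      ring
    have g1 : |∑ i, z i / S * (I.meanCost j i - A j i)|
        ≤ ∑ i, z i / S * |A j i - I.meanCost j i| := by
      refine (Finset.abs_sum_le_sum_abs _ _).trans (Finset.sum_le_sum fun i _ => ?_)
      rw [abs_mul, abs_of_nonneg (hp i), abs_sub_comm]
    have g2 : |((A *ᵥ z) j - β j) / S| ≤ e / S := by
      rw [abs_div, abs_of_pos hS]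
      exact div_le_div_of_nonneg_right (hAz j) hS.le
    have hβj : |β j| ≤ 6 / 5 * I.b := by
      have h6 := abs_le.1 (hβ j)
      have h7 := hI.eps_le
      rw [abs_le]
      constructor <;> linarith [h6.1, h6.2]
    -- The price of normalizing `z`. The `1/b` in the bound on `|S - 1|` cancels against `|β j| ≤
    -- 6b/5`.
    have g3 : |β j * (1 - S) / S| ≤ 6 / 5 * e / S := by
      rw [abs_div, abs_of_pos hS, abs_mul, abs_sub_comm]
      refine div_le_div_of_nonneg_right ?_ hS.le
      calc |β j| * |S - 1| ≤ 6 / 5 * I.b * (e / I.b) :=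
            mul_le_mul hβj h1 (abs_nonneg _) (by positivity)
        _ = 6 / 5 * e := by field_simp
    have g4 : e / S + 6 / 5 * e / S ≤ 4 * e := by
      rw [← add_div, div_le_iff₀ hS]
      nlinarith
    rw [hsplit]
    exact (abs_add_three _ _ _).trans (by linarith)

end Instance.Stable

end Stability

/-! ### Behaviour along a typical trajectory -/

section Trajectory

variable {d : ℕ} [NeZero d] {Ω : Type*} {I : Instance d d} {X : History d d Ω} {T : ℕ}
  {x : Fin d → ℝ} {epsLP : ℝ} {ω : Ω} {t : ℕ}

theorem alive_zero : X.Alive I T 0 ω := fun j => by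
  have := I.b_pos
  simp only [History.budget]
  simp
  positivity

theorem avgBudget_zero (hT : 0 < T) (j : Fin d) : X.avgBudget I T 0 ω j = I.b := by
  have : (T : ℝ) ≠ 0 := by positivity
  simp [History.avgBudget, History.budget, this]

theorem inRange_zero (hI : I.Stable x) (hT : 0 < T) : X.InRange I T x 0 ω := fun j => by
  rw [avgBudget_zero hT]
  constructor <;> linarith [hI.eps_pos]

/-- Since `ε ≤ b/5`, an in-range average budget is positive. Hence the range condition in `𝓔_t`
keeps the run inside the regime where its rules apply. -/
theorem History.InRange.alive (hI : I.Stable x) (hT : t < T) (h : X.InRange I T x t ω) :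
    X.Alive I T t ω := fun j => by
  have h1 : (0 : ℝ) < T - t := sub_pos.2 (Nat.cast_lt.2 hT)
  have h2 : 0 ≤ X.avgBudget I T t ω j := by
    linarith [(h j).1, hI.eps_le, I.b_pos]
  rw [History.avgBudget] at h2
  simpa [h1.ne'] using mul_nonneg h2 h1.le

theorem History.sum_pulls (i : Fin d) (f : ℕ → ℝ) :
    ∑ s ∈ X.pulls t ω i, f s = ∑ s ∈ Finset.Icc 1 t, if X.arm s ω = i then f s else 0 := by
  rw [History.pulls, Finset.sum_filter]

variable [mΩ : MeasurableSpace Ω] {P : Measure Ω} {ℱ : Filtration ℕ mΩ}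

/-- The almost sure properties of a run hold at `ω`. -/
structure Typical (I : Instance d d) (X : History d d Ω) (T : ℕ) (P : Measure Ω)
    (ℱ : Filtration ℕ mΩ) (x : Fin d → ℝ) (epsLP : ℝ) (ω : Ω) : Prop where
  solver : ∀ s < T, X.Alive I T s ω → X.Accurate I T x s ω ∧ X.InRange I T x s ω →
    IsApproxLP₂ (X.rewardUCB T s ω) (X.costLCB I T s ω) (X.budget I T s ω)
      (lpAccuracy T epsLP s) (X.sol (s + 1) ω)
  prob : ∀ s < T, ∀ i, X.Alive I T s ω → 0 < ∑ k, X.sol (s + 1) ω k →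
    X.armProb P ℱ i (s + 1) ω = X.sol (s + 1) ω i / ∑ k, X.sol (s + 1) ω k
  time : ∀ s < T, X.Alive I T s ω → X.cost (s + 1) ω 0 = I.b
  mean_mem : ∀ s j, (P[fun ω' => X.cost (s + 1) ω' j | ℱ s]) ω ∈ Set.Icc (0 : ℝ) 1
  mean : ∀ s < T, ∀ j, X.Alive I T s ω → (P[fun ω' => X.cost (s + 1) ω' j | ℱ s]) ω
    = ∑ i, X.armProb P ℱ i (s + 1) ω * I.meanCost j i

theorem IsRun.typical [IsProbabilityMeasure P] (hX : IsRun I X T P ℱ x epsLP) :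
    ∀ᵐ ω ∂P, Typical I X T P ℱ x epsLP ω := by
  have hmean : ∀ᵐ ω ∂P, ∀ s j,
      (P[fun ω' => X.cost (s + 1) ω' j | ℱ s]) ω ∈ Set.Icc (0 : ℝ) 1 := by
    refine ae_all_iff.2 fun s => ae_all_iff.2 fun j => ?_
    have hm := hX.cost_mem (s + 1)
    have hcost : Integrable (fun ω => X.cost (s + 1) ω j) P :=
      Integrable.of_bound
        ((hX.measurable_cost (s + 1) j).mono (ℱ.le _) le_rfl).aestronglyMeasurable 1
        (Filter.Eventually.of_forall fun ω => by
          rw [Real.norm_eq_abs, abs_of_nonneg (hm ω j).1]; exact (hm ω j).2)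
    have h0 := condExp_nonneg (m := ℱ s) (μ := P) (f := fun ω => X.cost (s + 1) ω j)
      (Filter.Eventually.of_forall fun ω => (hm ω j).1)
    have h1 := condExp_mono (m := ℱ s) hcost (integrable_const (1 : ℝ))
      (Filter.Eventually.of_forall fun ω => (hm ω j).2)
    rw [condExp_const (ℱ.le s)] at h1
    filter_upwards [h0, h1] with ω h0 h1 using ⟨h0, h1⟩
  have h1 := ae_all_iff.2 fun s => ae_all_iff.2 fun hs : s < T => hX.solver₂ s hs
  have h2 := ae_all_iff.2 fun s => ae_all_iff.2 fun hs : s < T => ae_all_iff.2 fun i =>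
    hX.armProb_eq i hs
  have h3 := ae_all_iff.2 fun s => ae_all_iff.2 fun hs : s < T => hX.cost_time hs
  have h4 := ae_all_iff.2 fun s => ae_all_iff.2 fun hs : s < T => ae_all_iff.2 fun j =>
    hX.condExp_cost j hs
  filter_upwards [h1, h2, h3, h4, hmean] with ω h1 h2 h3 h4 h5
  exact ⟨h1, h2, h3, h5, h4⟩

/-- The two noise processes are small before round `t`. -/
structure Concentrated (I : Instance d d) (X : History d d Ω) (T : ℕ) (P : Measure Ω)
    (ℱ : Filtration ℕ mΩ) (t : ℕ) (ω : Ω) : Prop where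
  cost : ∀ i j, |∑ s ∈ Finset.Icc 1 (t - 1), X.costDev I T i j s ω|
    ≤ Real.sqrt (2 * (5 * Real.log T) * t)
  arm : ∀ i, |∑ s ∈ Finset.Icc 1 (t - 1), X.armDev P ℱ i s ω|
    ≤ Real.sqrt (2 * (5 * Real.log T) * t)

theorem Typical.budget_time (hω : Typical I X T P ℱ x epsLP ω) (ht : t < T)
    (hal : ∀ s ≤ t, X.Alive I T s ω) : X.avgBudget I T t ω 0 = I.b := by
  have h1 : (0 : ℝ) < T - t := sub_pos.2 (Nat.cast_lt.2 ht)
  have h2 : ∑ s ∈ Finset.Icc 1 t, X.cost s ω 0 = ∑ s ∈ Finset.Icc 1 t, I.b := by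
    refine Finset.sum_congr rfl fun s hs => ?_
    obtain ⟨hs1, hs2⟩ := Finset.mem_Icc.1 hs
    have := hω.time (s - 1) (by omega) (hal _ (by omega))
    rwa [Nat.sub_add_cancel hs1] at this
  rw [History.avgBudget, History.budget, h2, div_eq_iff h1.ne']
  simp
  ring

/-- Once the estimates are accurate and the budget is in range, arms are played with frequencies
close to `x`, and the mean consumption is close to the average remaining budget. -/
theorem Typical.armProb_bounds (hI : I.Stable x) (hω : Typical I X T P ℱ x epsLP ω) (ht : t < T)
    (hal : ∀ s ≤ t, X.Alive I T s ω) (hr : X.InRange I T x t ω) (hacc : X.Accurate I T x t ω)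
    (he0 : 0 ≤ epsLP / Real.log T ^ 2)
    (he : epsLP / Real.log T ^ 2 ≤ I.sigma x * minWeight x / (40 * (d : ℝ) ^ (3 / 2 : ℝ))) :
    (∀ i, 2 / 3 * x i ≤ X.armProb P ℱ i (t + 1) ω ∧ X.armProb P ℱ i (t + 1) ω ≤ 3 / 2 * x i) ∧
      ∀ j, |(P[fun ω' => X.cost (t + 1) ω' j | ℱ t]) ω - X.avgBudget I T t ω j|
        ≤ ∑ i, X.armProb P ℱ i (t + 1) ω * |X.costLCB I T t ω j i - I.meanCost j i|
          + 4 * (epsLP / Real.log T ^ 2) := by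
  have hτ : (0 : ℝ) < T - t := sub_pos.2 (Nat.cast_lt.2 ht)
  have hsol := hω.solver t ht (hal t le_rfl) ⟨hacc, hr⟩
  set ξ := X.sol (t + 1) ω
  set τ : ℝ := T - t
  have hA : ∀ j i, |X.costLCB I T t ω j i - I.meanCost j i| ≤ I.theta x := fun j i => by
    simpa using (norm_le_pi_norm (fun j => X.costLCB I T t ω j i - I.meanCost j i) j).trans
      (hacc i)
  have hA0 : ∀ i, X.costLCB I T t ω 0 i = I.b := fun i => by simp [History.costLCB]
  have hβ : ∀ j, |X.avgBudget I T t ω j - I.b| ≤ I.eps x := fun j => by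
    rw [abs_le]
    constructor <;> linarith [(hr j).1, (hr j).2]
  -- Dividing by the remaining rounds gives the per-round system, with a solver error that no longer
  -- depends on `t`.
  have hAz : ∀ j, |(X.costLCB I T t ω *ᵥ fun i => ξ i / τ) j - X.avgBudget I T t ω j|
      ≤ epsLP / Real.log T ^ 2 := fun j => by
    have h1 : (X.costLCB I T t ω *ᵥ fun i => ξ i / τ) j - X.avgBudget I T t ω j
        = ((X.costLCB I T t ω *ᵥ ξ) j - X.budget I T t ω j) / τ := by
      rw [History.avgBudget, sub_div]
      congr 1
      simp only [Matrix.mulVec, dotProduct, Finset.sum_div]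
      exact Finset.sum_congr rfl fun i _ => by ring
    have h2 : lpAccuracy T epsLP t = epsLP / Real.log T ^ 2 * τ := by
      simp only [lpAccuracy, τ]
      ring
    rw [h1, abs_div, abs_of_pos hτ, div_le_iff₀ hτ, ← h2, abs_le]
    constructor <;> linarith [hsol.2.1 j, hsol.2.2.1 j]
  obtain ⟨h1, h2, h3⟩ := hI.normalized_bounds he0 he hA hA0 hβ (hω.budget_time ht hal)
    (fun i => div_nonneg (hsol.1 i) hτ.le) hAz
  have hsum : ∑ i, ξ i / τ = (∑ i, ξ i) / τ := by rw [Finset.sum_div]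
  have hpos : 0 < ∑ i, ξ i := by
    rw [hsum] at h1
    exact (div_pos_iff_of_pos_right hτ).1 h1
  have hp : ∀ i, X.armProb P ℱ i (t + 1) ω = ξ i / τ / ∑ k, ξ k / τ := fun i => by
    rw [hω.prob t ht i (hal t le_rfl) hpos, hsum, div_div_div_cancel_right₀ hτ.ne']
  refine ⟨fun i => hp i ▸ h2 i, fun j => ?_⟩
  rw [hω.mean t ht j (hal t le_rfl)]
  simp only [hp]
  exact h3 j

/-- Doob decomposition of the pull count. -/
theorem History.card_pulls (i : Fin d) :
    ((X.pulls t ω i).card : ℝ) = ∑ s ∈ Finset.Icc 1 t, X.armDev P ℱ i s ω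
      + ∑ s ∈ Finset.Icc 1 t, X.armProb P ℱ i s ω := by
  have h := X.sum_pulls (t := t) (ω := ω) i fun _ => 1
  rw [Finset.sum_const, nsmul_eq_mul, mul_one] at h
  rw [h, ← Finset.sum_add_distrib]
  refine Finset.sum_congr rfl fun s _ => ?_
  rw [History.armDev, sub_add_cancel]
  by_cases harm : X.arm s ω = i
  · rw [if_pos harm, Set.indicator_of_mem (show ω ∈ X.armEvent s i from harm)]
  · rw [if_neg harm, Set.indicator_of_notMem (show ω ∉ X.armEvent s i from harm)]

theorem History.sum_cost_pulls (hal : ∀ s < t, X.Alive I T s ω) (i j : Fin d) :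
    ∑ s ∈ X.pulls t ω i, X.cost s ω j - (X.pulls t ω i).card * I.meanCost j i
      = ∑ s ∈ Finset.Icc 1 t, X.costDev I T i j s ω := by
  have h := X.sum_pulls (t := t) (ω := ω) i fun s => X.cost s ω j - I.meanCost j i
  rw [Finset.sum_sub_distrib, Finset.sum_const, nsmul_eq_mul] at h
  rw [h]
  refine Finset.sum_congr rfl fun s hs => ?_
  have hs1 : ω ∈ X.aliveEvent I T (s - 1) := hal _ (by
    have := Finset.mem_Icc.1 hs
    omega)
  by_cases harm : X.arm s ω = i
  · have hmem : ω ∈ X.aliveEvent I T (s - 1) ∩ X.armEvent s i := ⟨hs1, harm⟩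
    rw [if_pos harm, History.costDev, Set.indicator_of_mem hmem]
  · have hmem : ω ∉ X.aliveEvent I T (s - 1) ∩ X.armEvent s i := fun h => harm h.2
    rw [if_neg harm, History.costDev, Set.indicator_of_notMem hmem]

theorem History.abs_costLCB_sub_le (hal : ∀ s < t, X.Alive I T s ω) (i j : Fin d)
    (hn : 0 < (X.pulls t ω i).card) :
    |X.costLCB I T t ω j i - I.meanCost j i|
      ≤ |∑ s ∈ Finset.Icc 1 t, X.costDev I T i j s ω| / (X.pulls t ω i).card
        + X.radius T t ω i := by
  have hrad : 0 ≤ X.radius T t ω i := Real.sqrt_nonneg _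
  have hn' : (0 : ℝ) < (X.pulls t ω i).card := Nat.cast_pos.2 hn
  by_cases hj : j = 0
  · rw [History.costLCB, if_pos hj, hj, I.meanCost_time, sub_self, abs_zero]
    positivity
  · rw [← X.sum_cost_pulls hal i j, History.costLCB, if_neg hj, if_neg hn.ne',
      ← abs_of_pos hn', ← abs_div, abs_of_pos hn', sub_div, mul_div_cancel_left₀ _ hn'.ne']
    have hC := (I.meanCost_mem j i).1
    set μ := (∑ s ∈ X.pulls t ω i, X.cost s ω j) / (X.pulls t ω i).card
    -- The true mean is nonnegative, so cutting off at `0` can only bring the estimate closer to it.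
    have h1 : |max 0 (μ - X.radius T t ω i) - I.meanCost j i|
        ≤ |μ - X.radius T t ω i - I.meanCost j i| := by
      rcases le_total (μ - X.radius T t ω i) 0 with h | h
      · rw [max_eq_left h, zero_sub, abs_neg, abs_of_nonneg hC, abs_of_nonpos (by linarith)]
        linarith
      · rw [max_eq_right h]
    refine h1.trans ?_
    rw [show μ - X.radius T t ω i - I.meanCost j i
      = (μ - I.meanCost j i) - X.radius T t ω i by ring]
    exact (abs_sub _ _).trans_eq (by rw [abs_of_nonneg hrad])

end Trajectory

/-! ### The deviation bound -/

section Deviation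

variable {d : ℕ} [NeZero d] {Ω : Type*} [mΩ : MeasurableSpace Ω] {P : Measure Ω}
  {ℱ : Filtration ℕ mΩ} {I : Instance d d} {X : History d d Ω} {T : ℕ} {x : Fin d → ℝ}
  {epsLP K : ℝ} {ω : Ω} {t : ℕ}

/-- Here `1440 = 10 · 12²`. With `c = χ` the fluctuation of a pull count is at most `χ t/12`. -/
theorem sqrt_noise_le {c : ℝ} (hc : 0 ≤ c)
    (h : 1440 * Real.log T ≤ c ^ 2 * t) :
    Real.sqrt (2 * (5 * Real.log T) * t) ≤ c * t / 12 := by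
  refine Real.sqrt_le_iff.2 ⟨by positivity, ?_⟩
  nlinarith [mul_le_mul_of_nonneg_right h (Nat.cast_nonneg (α := ℝ) t)]

/-- Before a late round, every arm has been pulled a constant fraction of the time. -/
theorem Typical.card_pulls_ge (hI : I.Stable x) (hω : Typical I X T P ℱ x epsLP ω)
    (hconc : Concentrated I X T P ℱ t ω) (ht : t ≤ T) (hL : 0 < Real.log T)
    (hr : ∀ s ∈ Finset.Icc 1 (t - 1), X.InRange I T x s ω)
    (hacc : ω ∈ accurateEvent I X T x K t)
    (he0 : 0 ≤ epsLP / Real.log T ^ 2)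
    (he : epsLP / Real.log T ^ 2 ≤ I.sigma x * minWeight x / (40 * (d : ℝ) ^ (3 / 2 : ℝ)))
    (h1 : 8 * (3 + max K 0 * Real.log T) ≤ t) (h2 : 1440 * Real.log T ≤ minWeight x ^ 2 * t)
    (i : Fin d) : x i * t / 2 ≤ (X.pulls (t - 1) ω i).card := by
  have hx := pos_of_optimalArms hI.arms i
  have hK : 0 ≤ max K 0 * Real.log T := mul_nonneg (le_max_right _ _) hL.le
  have ht24 : 24 ≤ t := by
    have : (24 : ℝ) ≤ t := by linarith
    exact_mod_cast this
  have hal : ∀ s ≤ t - 1, X.Alive I T s ω := fun s hs => by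
    rcases Nat.eq_zero_or_pos s with rfl | hs0
    · exact alive_zero
    · exact (hr s (Finset.mem_Icc.2 ⟨hs0, hs⟩)).alive hI (by omega)
  -- Round `s ≥ k + 1` uses the estimates after round `s - 1 ≥ k`, past the initial stage. The extra
  -- `1` gives `s - 1 ≥ 1`, where the range hypothesis applies; `max K 0` covers negative `K`.
  set k := ⌈1 + max K 0 * Real.log T⌉₊
  have hk1 : 1 + max K 0 * Real.log T ≤ k := Nat.le_ceil _
  have hk2 : (k : ℝ) < 1 + max K 0 * Real.log T + 1 := Nat.ceil_lt_add_one (by positivity)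
  have hkt : k + 1 ≤ t := by
    have : ((k + 1 : ℕ) : ℝ) ≤ t := by push_cast; linarith
    exact_mod_cast this
  have hk0 : 1 ≤ k := by
    have : ((1 : ℕ) : ℝ) ≤ k := by push_cast; linarith
    exact_mod_cast this
  have hprob : ∀ s ∈ Finset.Icc (k + 1) (t - 1), 2 / 3 * x i ≤ X.armProb P ℱ i s ω := by
    intro s hs
    obtain ⟨hs1, hs2⟩ := Finset.mem_Icc.1 hs
    have hks : ((k : ℕ) : ℝ) ≤ (s - 1 : ℕ) := Nat.cast_le.2 (by omega)
    have hKs : K * Real.log T ≤ (s - 1 : ℕ) := by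
      have := mul_le_mul_of_nonneg_right (le_max_left K 0) hL.le
      linarith
    have h := (hω.armProb_bounds (t := s - 1) hI (by omega) (fun u hu => hal u (by omega))
      (hr _ (Finset.mem_Icc.2 ⟨by omega, by omega⟩)) (hacc _ hKs (by omega)) he0 he).1 i
    rw [Nat.sub_add_cancel (by omega)] at h
    exact h.1
  have hsum : 2 / 3 * x i * (t - 3 - max K 0 * Real.log T)
      ≤ ∑ s ∈ Finset.Icc 1 (t - 1), X.armProb P ℱ i s ω := by
    calc 2 / 3 * x i * (t - 3 - max K 0 * Real.log T)
        ≤ 2 / 3 * x i * ((t - 1 + 1 - (k + 1) : ℕ) : ℝ) := by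
          refine mul_le_mul_of_nonneg_left ?_ (by positivity)
          rw [Nat.sub_add_cancel (by omega), Nat.cast_sub hkt]
          push_cast
          linarith
      _ = ∑ s ∈ Finset.Icc (k + 1) (t - 1), 2 / 3 * x i := by
          rw [Finset.sum_const, nsmul_eq_mul, Nat.card_Icc, mul_comm]
      _ ≤ ∑ s ∈ Finset.Icc (k + 1) (t - 1), X.armProb P ℱ i s ω := Finset.sum_le_sum hprob
      _ ≤ _ := Finset.sum_le_sum_of_subset_of_nonneg
          (Finset.Icc_subset_Icc (by omega) le_rfl) fun s _ _ => le_max_left _ _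
  have hdev := (abs_le.1 (hconc.arm i)).1
  have hsq := sqrt_noise_le hI.minWeight_pos.le h2
  have hχ := mul_le_mul_of_nonneg_right (hI.minWeight_le i) (Nat.cast_nonneg (α := ℝ) t)
  rw [X.card_pulls (P := P) (ℱ := ℱ) i]
  have h3 := mul_le_mul_of_nonneg_left h1 hx.le
  -- The initial stage costs at most `t/8`, so the count is at least `x_i t (2/3 · 7/8 - 1/12) = x_i
  -- t/2`.
  linarith

/-- In a late round the mean consumption deviates little from the average remaining budget. -/
theorem Typical.abs_mean_sub_le (hI : I.Stable x) (hω : Typical I X T P ℱ x epsLP ω)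
    (hconc : Concentrated I X T P ℱ t ω) (ht : t ≤ T) (hL : 0 < Real.log T)
    (hr : ∀ s ∈ Finset.Icc 1 (t - 1), X.InRange I T x s ω)
    (hacc : ω ∈ accurateEvent I X T x K t)
    (he0 : 0 ≤ epsLP / Real.log T ^ 2)
    (he : epsLP / Real.log T ^ 2 ≤ I.sigma x * minWeight x / (40 * (d : ℝ) ^ (3 / 2 : ℝ)))
    (h1 : 8 * (3 + max K 0 * Real.log T) ≤ t) (h2 : 1440 * Real.log T ≤ minWeight x ^ 2 * t)
    (j : Fin d) :
    |(P[fun ω' => X.cost t ω' j | ℱ (t - 1)]) ω - X.avgBudget I T (t - 1) ω j|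
      ≤ 19 * d * Real.sqrt (Real.log T / t) + 4 * (epsLP / Real.log T ^ 2) := by
  have hK : 0 ≤ max K 0 * Real.log T := mul_nonneg (le_max_right _ _) hL.le
  have ht24' : (24 : ℝ) ≤ t := by linarith
  have ht24 : 24 ≤ t := by exact_mod_cast ht24'
  have ht0 : (0 : ℝ) < t := by linarith
  have hal : ∀ s ≤ t - 1, X.Alive I T s ω := fun s hs => by
    rcases Nat.eq_zero_or_pos s with rfl | hs0
    · exact alive_zero
    · exact (hr s (Finset.mem_Icc.2 ⟨hs0, hs⟩)).alive hI (by omega)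
  have hKt : K * Real.log T ≤ (t - 1 : ℕ) := by
    have := mul_le_mul_of_nonneg_right (le_max_left K 0) hL.le
    rw [Nat.cast_sub (by omega)]
    push_cast
    linarith
  obtain ⟨hp, hmean⟩ := hω.armProb_bounds (t := t - 1) hI (by omega) hal
    (hr _ (Finset.mem_Icc.2 ⟨by omega, by omega⟩)) (hacc _ hKt le_rfl) he0 he
  rw [Nat.sub_add_cancel (by omega)] at hp hmean
  refine (hmean j).trans ?_
  gcongr
  set r := Real.sqrt (Real.log T / t)
  have hr0 : 0 ≤ r := Real.sqrt_nonneg _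
  have hr2 : r ^ 2 = Real.log T / t := Real.sq_sqrt (by positivity)
  have hLr : Real.log T = r ^ 2 * t := by rw [hr2]; field_simp
  calc ∑ i, X.armProb P ℱ i t ω * |X.costLCB I T (t - 1) ω j i - I.meanCost j i|
      ≤ ∑ _i : Fin d, 19 * r := Finset.sum_le_sum fun i _ => ?_
    _ = 19 * d * r := by
        rw [Finset.sum_const, Finset.card_univ, Fintype.card_fin, nsmul_eq_mul]
        ring
  have hx := pos_of_optimalArms hI.arms i
  have hn := hω.card_pulls_ge hI hconc ht hL hr hacc he0 he h1 h2 i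
  set n := (X.pulls (t - 1) ω i).card
  have hn0' : (0 : ℝ) < n := lt_of_lt_of_le (by positivity) hn
  have hn0 : 0 < n := by exact_mod_cast hn0'
  set p := X.armProb P ℱ i t ω
  have hp0 : 0 ≤ p := le_max_left _ _
  have hp1 : p ≤ 1 := max_le zero_le_one (min_le_left _ _)
  -- The cancellation of `x i`: `p ≤ 3/2 x i` against `n ≥ x i t/2`. A rarely played arm is poorly
  -- estimated but also contributes little.
  have hpn : p * t ≤ 3 * n := by
    have := mul_le_mul_of_nonneg_right (hp i).2 ht0.le
    linarith
  have herr := X.abs_costLCB_sub_le (t := t - 1) (fun s hs => hal s hs.le) i j hn0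
  -- The noise is at most `√10 r t`, and `(16/5)² ≥ 10`.
  have hM : |∑ s ∈ Finset.Icc 1 (t - 1), X.costDev I T i j s ω| ≤ 16 / 5 * r * t := by
    refine (hconc.cost i j).trans (Real.sqrt_le_iff.2 ⟨by positivity, ?_⟩)
    rw [hLr]
    nlinarith [mul_nonneg (sq_nonneg r) (sq_nonneg (t : ℝ))]
  have hA : p * (|∑ s ∈ Finset.Icc 1 (t - 1), X.costDev I T i j s ω| / n) ≤ 48 / 5 * r := by
    rw [← mul_div_assoc, div_le_iff₀ hn0']
    calc p * |∑ s ∈ Finset.Icc 1 (t - 1), X.costDev I T i j s ω|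
        ≤ p * (16 / 5 * r * t) := mul_le_mul_of_nonneg_left hM hp0
      _ = 16 / 5 * r * (p * t) := by ring
      _ ≤ 16 / 5 * r * (3 * n) := mul_le_mul_of_nonneg_left hpn (by positivity)
      _ = 48 / 5 * r * n := by ring
  -- The square is `2 r² p (p t)/n ≤ 6 r²`, using `p ≤ 1` once. In total `48/5 + 3 ≤ 19`.
  have hB : p * X.radius T (t - 1) ω i ≤ 3 * r := by
    refine le_of_sq_le_sq ?_ (by positivity)
    have hq : X.radius T (t - 1) ω i ^ 2 = 2 * Real.log T / n :=
      Real.sq_sqrt (div_nonneg (by linarith) hn0'.le)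
    rw [mul_pow, hq, hLr, ← mul_div_assoc, div_le_iff₀ hn0']
    have h3 : p * (p * t) ≤ 1 * (3 * n) := mul_le_mul hp1 hpn (by positivity) zero_le_one
    nlinarith [mul_le_mul_of_nonneg_left h3 (sq_nonneg r), mul_nonneg (sq_nonneg r) hn0'.le]
  have hC := mul_le_mul_of_nonneg_left herr hp0
  linarith

theorem Typical.abs_mean_sub_le_early (hI : I.Stable x) (hω : Typical I X T P ℱ x epsLP ω)
    (ht1 : 1 ≤ t) (ht : t ≤ T) (hr : ∀ s ∈ Finset.Icc 1 (t - 1), X.InRange I T x s ω) (j : Fin d) :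
    |(P[fun ω' => X.cost t ω' j | ℱ (t - 1)]) ω - X.avgBudget I T (t - 1) ω j| ≤ 6 / 5 := by
  have hin : X.InRange I T x (t - 1) ω := by
    -- In round `1` the event imposes no range condition; the initial budget is exactly on target.
    rcases Nat.eq_zero_or_pos (t - 1) with h | h
    · rw [h]; exact inRange_zero hI (by omega)
    · exact hr _ (Finset.mem_Icc.2 ⟨h, le_rfl⟩)
  have h1 := hω.mean_mem (t - 1) j
  rw [Nat.sub_add_cancel ht1] at h1
  have h2 := hin j
  have h3 := hI.eps_le
  rw [abs_le]
  constructor <;> linarith [h1.1, h1.2, h2.1, h2.2, I.b_pos, I.b_le_one]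

/-- The size conditions `h1`, `h2` are imposed at the switching time `α T/19`, so they pass to every
late round. -/
theorem Typical.notMem_deviationEvent (hI : I.Stable x) (hω : Typical I X T P ℱ x epsLP ω)
    (hconc : Concentrated I X T P ℱ t ω) (ht1 : 1 ≤ t) (ht : t ≤ T) (hL : 0 < Real.log T)
    (he0 : 0 ≤ epsLP)
    (he : epsLP ≤ I.sigma x * minWeight x * Real.log T ^ 2
        / (40 * min ((d : ℝ) ^ (3 / 2 : ℝ)) ((d : ℝ) ^ (3 / 2 : ℝ))))
    (h1 : 8 * (3 + max K 0 * Real.log T) ≤ I.alpha x * T / 19)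
    (h2 : 1440 * Real.log T ≤ minWeight x ^ 2 * (I.alpha x * T / 19)) :
    ω ∉ deviationEvent I X T P ℱ x epsLP t ∩ accurateEvent I X T x K t := by
  rintro ⟨⟨hr, hdev⟩, hacc⟩
  refine hdev.not_ge ?_
  have hσ := hI.sigma_pos
  have hb := I.b_pos
  have hd1 : (1 : ℝ) ≤ d := one_le_natCast_of_neZero
  have hs1 : (1 : ℝ) ≤ Real.sqrt d := one_le_sqrt_natCast
  unfold Instance.epsRound
  split_ifs with hlt
  · exact (pi_norm_le_iff_of_nonneg (by norm_num)).2 fun j =>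
      hω.abs_mean_sub_le_early hI ht1 ht hr j
  · rw [not_lt] at hlt
    rw [min_self, min_self]
    have hpow : (0 : ℝ) ≤ (d : ℝ) ^ (5 / 2 : ℝ) := by positivity
    refine (pi_norm_le_iff_of_nonneg (by positivity)).2 fun j => ?_
    have he' : epsLP / Real.log T ^ 2
        ≤ I.sigma x * minWeight x / (40 * (d : ℝ) ^ (3 / 2 : ℝ)) := by
      rw [min_self] at he
      rw [div_le_iff₀ (by positivity)]
      exact he.trans_eq (by ring)
    have he0' : 0 ≤ epsLP / Real.log T ^ 2 := by positivity
    refine (hω.abs_mean_sub_le hI hconc ht hL hr hacc he0' he' (h1.trans hlt)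
      (h2.trans (mul_le_mul_of_nonneg_left hlt (sq_nonneg _))) j).trans (add_le_add ?_ ?_)
    · refine mul_le_mul_of_nonneg_right ?_ (Real.sqrt_nonneg _)
      rw [le_div_iff₀ hσ]
      have := mul_le_mul_of_nonneg_left hI.sigma_le (show (0 : ℝ) ≤ 19 * d by positivity)
      linarith
    -- `σ ≤ √d ≤ d^(5/2)` turns the solver term `4e` into the one in `ε_t`.
    · have hσ5 : I.sigma x ≤ (d : ℝ) ^ (5 / 2 : ℝ) :=
        hI.sigma_le.trans ((mul_le_of_le_one_left (by positivity) I.b_le_one).trans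
          sqrt_natCast_le_rpow_five_halves)
      rw [← div_div, ← mul_div_assoc]
      refine div_le_div_of_nonneg_right ?_ (by positivity)
      rw [le_div_iff₀ hσ]
      have := mul_le_mul_of_nonneg_left hσ5 (show (0 : ℝ) ≤ 4 * epsLP by positivity)
      linarith

/-- The noise processes are uniformly small with high probability. -/
theorem IsRun.measure_not_concentrated_le [IsProbabilityMeasure P]
    (hX : IsRun I X T P ℱ x epsLP) (hT : 2 * ((d : ℝ) + 1) ≤ T) :
    P (⋃ t ∈ Finset.Icc 1 T, {ω | ¬ Concentrated I X T P ℱ t ω})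
      ≤ ENNReal.ofReal (d / (T : ℝ) ^ 3) := by
  have hd1 : (1 : ℝ) ≤ d := one_le_natCast_of_neZero
  have hT1 : (1 : ℝ) ≤ T := by linarith
  have hL : 0 ≤ Real.log T := Real.log_nonneg hT1
  have hexp : Real.exp (-(5 * Real.log T)) = ((T : ℝ) ^ 5)⁻¹ := by
    rw [Real.exp_neg, mul_comm, Real.exp_mul, Real.exp_log (by linarith)]
    norm_cast
  obtain ⟨q, hq⟩ : ∃ q : ℝ, q = 2 * ((T : ℝ) ^ 5)⁻¹ := ⟨_, rfl⟩
  rw [← hexp] at hq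
  have hround : ∀ t ∈ Finset.Icc 1 T, P {ω | ¬ Concentrated I X T P ℱ t ω}
      ≤ ENNReal.ofReal ((d * d + d) * q) := by
    intro t ht
    obtain ⟨ht1, ht2⟩ := Finset.mem_Icc.1 ht
    have hnt : ((t - 1 : ℕ) : ℝ) ≤ t := Nat.cast_le.2 (Nat.sub_le _ _)
    have ht0 : (0 : ℝ) < t := Nat.cast_pos.2 ht1
    have hc : ∀ i j, P {ω | Real.sqrt (2 * (5 * Real.log T) * t)
        < |∑ s ∈ Finset.Icc 1 (t - 1), X.costDev I T i j s ω|} ≤ ENNReal.ofReal q := fun i j => by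
      have := measure_abs_sum_gt_le (P := P) (ℱ := ℱ) (hX.measurable_costDev i j)
        (hX.abs_costDev_le i j) (fun s hs => hX.condExp_costDev i j (show s < T by omega))
        hnt ht0 (show 0 ≤ 5 * Real.log T by positivity)
      rwa [← hq] at this
    have ha : ∀ i, P {ω | Real.sqrt (2 * (5 * Real.log T) * t)
        < |∑ s ∈ Finset.Icc 1 (t - 1), X.armDev P ℱ i s ω|} ≤ ENNReal.ofReal q := fun i => by
      have := measure_abs_sum_gt_le (P := P) (ℱ := ℱ) (hX.measurable_armDev i)
        (History.abs_armDev_le i) (fun s _ => hX.condExp_armDev i s)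
        hnt ht0 (show 0 ≤ 5 * Real.log T by positivity)
      rwa [← hq] at this
    have hsub : {ω | ¬ Concentrated I X T P ℱ t ω} ⊆
        (⋃ i, ⋃ j, {ω | Real.sqrt (2 * (5 * Real.log T) * t)
          < |∑ s ∈ Finset.Icc 1 (t - 1), X.costDev I T i j s ω|}) ∪
        ⋃ i, {ω | Real.sqrt (2 * (5 * Real.log T) * t)
          < |∑ s ∈ Finset.Icc 1 (t - 1), X.armDev P ℱ i s ω|} := by
      intro ω hω
      by_contra hcon
      simp only [Set.mem_union, Set.mem_iUnion, Set.mem_ofPred_eq, not_or, not_exists,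
        not_lt] at hcon
      exact hω ⟨hcon.1, hcon.2⟩
    calc _ ≤ _ := measure_mono hsub
      _ ≤ _ := measure_union_le _ _
      _ ≤ ∑ i : Fin d, ∑ j : Fin d, ENNReal.ofReal q + ∑ i : Fin d, ENNReal.ofReal q :=
          add_le_add
            ((measure_iUnion_fintype_le _ _).trans (Finset.sum_le_sum fun i _ =>
              (measure_iUnion_fintype_le _ _).trans (Finset.sum_le_sum fun j _ => hc i j)))
            ((measure_iUnion_fintype_le _ _).trans (Finset.sum_le_sum fun i _ => ha i))
      _ = ENNReal.ofReal ((d * d + d) * q) := by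
          simp only [Finset.sum_const, Finset.card_univ, Fintype.card_fin, nsmul_eq_mul]
          rw [ENNReal.ofReal_mul (by positivity), ENNReal.ofReal_add (by positivity)
            (by positivity), ENNReal.ofReal_mul (by positivity), ENNReal.ofReal_natCast]
          ring
  calc _ ≤ ∑ t ∈ Finset.Icc 1 T, P {ω | ¬ Concentrated I X T P ℱ t ω} :=
        measure_biUnion_finset_le _ _
    _ ≤ ∑ t ∈ Finset.Icc 1 T, ENNReal.ofReal ((d * d + d) * q) := Finset.sum_le_sum hround
    _ = ENNReal.ofReal (T * ((d * d + d) * q)) := by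
        rw [Finset.sum_const, Nat.card_Icc, Nat.add_sub_cancel, nsmul_eq_mul,
          ENNReal.ofReal_mul (p := (T : ℝ)) (Nat.cast_nonneg T), ENNReal.ofReal_natCast]
    _ ≤ ENNReal.ofReal (d / (T : ℝ) ^ 3) := by
        -- Each martingale fails with probability at most `2/T⁵`. Over `d² + d` martingales and `T`
        -- rounds this is `d · 2(d+1)/T⁴`, and `T ≥ 2(d+1)` absorbs the last factor.
        refine ENNReal.ofReal_le_ofReal ?_
        have hT0 : (0 : ℝ) < T := by linarith
        have : T * ((d * d + d) * q) = d * (2 * ((d : ℝ) + 1)) / (T : ℝ) ^ 4 := by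
          rw [hq, hexp]
          field_simp
        rw [this, div_le_div_iff₀ (by positivity) (by positivity)]
        have := mul_le_mul_of_nonneg_left hT (show (0 : ℝ) ≤ d * (T : ℝ) ^ 3 by positivity)
        linarith

theorem exists_large_horizon {a A B : ℝ} (ha : 0 < a) :
    ∃ T₀ : ℕ, ∀ T : ℕ, T₀ < T → A + B * Real.log T ≤ a * T := by
  have h1 : (fun y : ℝ => A + B * Real.log y) =o[Filter.atTop] fun y : ℝ => y :=
    (Asymptotics.isLittleO_const_id_atTop A).add (Real.isLittleO_log_id_atTop.const_mul_left B)
  have h2 := (h1.comp_tendsto tendsto_natCast_atTop_atTop).bound ha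
  obtain ⟨N, hN⟩ := Filter.eventually_atTop.1 h2
  refine ⟨N, fun T hT => ?_⟩
  have h := hN T hT.le
  simp only [Function.comp_apply, Real.norm_eq_abs, Nat.abs_cast] at h
  exact (le_abs_self _).trans h

end Deviation

end BwK

theorem mainTheorem8 {m d : ℕ} [NeZero d] (I : BwK.Instance m d) (x : Fin m → ℝ)
    (hopt : I.IsOptimal x) (huniq : ∀ y, I.IsOptimal y → y = x)
    (hnondeg : (BwK.optimalArms x).card = (I.binding x).card)
    (harms : BwK.optimalArms x = Finset.univ) (hbind : I.binding x = Finset.univ) (K : ℝ) :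
    ∃ T₀ : ℕ, ∀ T : ℕ, T₀ < T → ∀ epsLP : ℝ, 0 ≤ epsLP →
      epsLP ≤ I.sigma x * BwK.minWeight x * Real.log T ^ 2
        / (40 * min ((m : ℝ) ^ (3 / 2 : ℝ)) ((d : ℝ) ^ (3 / 2 : ℝ))) →
      ∀ (Ω : Type*) [mΩ : MeasurableSpace Ω] (P : Measure Ω) [IsProbabilityMeasure P]
        (ℱ : Filtration ℕ mΩ) (X : BwK.History m d Ω),
        BwK.IsRun I X T P ℱ x epsLP →
        P (⋃ t ∈ Finset.Icc 1 T, BwK.deviationEvent I X T P ℱ x epsLP t ∩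
            BwK.accurateEvent I X T x K t)
          ≤ ENNReal.ofReal (min (m : ℝ) d / (T : ℝ) ^ 3) := by
  obtain rfl : m = d := by simpa [harms, hbind] using hnondeg
  have hI : I.Stable x :=
    ⟨harms, hbind, I.sigma_pos hopt huniq harms hbind, I.sigma_le hopt huniq harms hbind,
      I.gap_pos hopt huniq harms hbind⟩
  have hα := hI.alpha_pos
  have hχ := hI.minWeight_pos
  -- The two horizons make `α T/19` exceed `8(3 + max K 0 · log T)` and `1440 log T/χ²`.
  obtain ⟨T₁, h₁⟩ := BwK.exists_large_horizon (a := I.alpha x / 19) (A := 24)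
    (B := 8 * max K 0) (by positivity)
  obtain ⟨T₂, h₂⟩ := BwK.exists_large_horizon
    (a := BwK.minWeight x ^ 2 * (I.alpha x / 19)) (A := 0) (B := 1440) (by positivity)
  refine ⟨T₁ + T₂ + 2 * (m + 1), fun T hT epsLP he0 he Ω mΩ P _ ℱ X hX => ?_⟩
  have hT1 := h₁ T (by omega)
  have hT2 := h₂ T (by omega)
  have hT3 : 2 * ((m : ℝ) + 1) ≤ T := by
    have : 2 * (m + 1) ≤ T := by omega
    exact_mod_cast this
  have hL : 0 < Real.log T :=
    Real.log_pos (by linarith [Nat.cast_nonneg (α := ℝ) m])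
  rw [min_self]
  -- Outside a null set the argument is deterministic: a bad round forces concentration to fail for
  -- that round.
  refine le_trans (measure_mono_ae ?_) (hX.measure_not_concentrated_le hT3)
  filter_upwards [hX.typical] with ω hω hmem
  obtain ⟨t, ht, hdev⟩ := Set.mem_iUnion₂.1 hmem
  refine Set.mem_iUnion₂.2 ⟨t, ht, fun hconc => ?_⟩
  obtain ⟨ht1, ht2⟩ := Finset.mem_Icc.1 ht
  exact hω.notMem_deviationEvent hI hconc ht1 ht2 hL he0 he (by linarith) (by linarith) hdev
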